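/- **Theorem.** Let $n\ge 1$, let $U\subset\mathbb C^n$ be a domain, and let $\pi:\widetilde U\to U$ be a Riemann domain over $U$, i.e. a connected complex manifold $\widetilde U$ with a holomorphic unramified (locally biholomorphic) covering $\pi$. Write $\tilde z=(\tilde z^1,\dots,\tilde z^n)$ for the components of $\pi$, which are local holomorphic coordinates near every point, and $J$ for the complex structure of $\widetilde U$. Let $F:\widetilde U\to\mathbb C$ be a holomorphic function, put $F_{\tilde z^j}=\partial F/\partial\tilde z^j$, and suppose that $F$ is nondegenerate, i.e. the real matrix $\mathrm{Im}\,(\partial^2F/\partial\tilde z^i\partial\tilde z^j)$ is invertible at every point. Let $\phi=(\tilde z,\tilde w):\widetilde U\to T^*\mathbb C^n=\mathbb C^n\times\mathbb C^n$, $\tilde w_j=F_{\tilde z^j}$, let $\Omega=\sum dz^i\wedge dw_i$, $\gamma=\sqrt{-1}\,\Omega(\cdot,\bar\cdot)$, and put $g=\mathrm{Re}\,\phi^*\gamma$, $\tilde x^i=\mathrm{Re}\,\tilde z^i$, $\tilde y_j=\mathrm{Re}\,\tilde w_j$. Then: 1. There is a unique connection $\nabla$ on $\widetilde U$ for which all functions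 $\tilde x^i,\tilde y_j$ are affine ($\nabla d\tilde x^i=\nabla d\tilde y_j=0$), and $M(F)=(\widetilde U,J,g,\nabla)$ is a special Kähler manifold: $(\widetilde U,J,g)$ is a pseudo-Kähler manifold, $\nabla$ is smooth, flat and torsion-free, $\nabla J$ is symmetric, and the $2$-form $g(J\cdot,\cdot)$ is $\nabla$-parallel. Its Kähler form is $\omega=g(\cdot,J\cdot)=2\sum_i d\tilde x^i\wedge d\tilde y_i$. 2. The map $$\varphi_F=\Bigl(\tilde x^1,\dots,\tilde x^n,\ \tilde y_1,\dots,\tilde y_n,\ 2\,\mathrm{Im}\,F-2\sum_k\tilde y_k\,\mathrm{Im}\,\tilde z^k\Bigr):\widetilde U\to\mathbb R^{2n+1}$$ is an immersion which, with respect to the volume form $\mathrm{vol}=2^n\det$ on $\mathbb R^{2n+1}$ and for a suitable orientation of $\widetilde U$, is a special parabolic affine hypersphere with affine normal $\xi=\partial_{2n+1}$, Blaschke metric $g$, induced connection $\nabla$ and compatible almost complex structure $J$. Here $\xi$ is the affine normal, $g$ the Blaschke metric and $\nabla$ the induced connection of a hypersurface $\varphi$ if $\xi$ is transversal, $\widetilde\nabla_X(\varphi_*Y)=\varphi_*(\nabla_XY)+g(X,Y)\xi$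 with $\widetilde\nabla$ the standard connection, $g$ is nondegenerate, and the form $\nu=\mathrm{vol}(\xi,\dots)$ is $\nabla$-parallel and equal to the metric volume form of $g$; the hypersurface is a parabolic hypersphere if $\widetilde\nabla\xi=0$; and an almost complex structure $J$ is compatible (and the hypersphere special) if $J$ is $g$-skew and $g(J\cdot,\cdot)$ is $\nabla$-parallel. 3. $\varphi_F$ is unique up to unimodular affine transformations: if $\psi:\widetilde U\to\mathbb R^{2n+1}$ is, for some orientation of $\widetilde U$, a special parabolic affine hypersphere with respect to $\mathrm{vol}$ with Blaschke metric $g$, induced connection $\nabla$ and compatible almost complex structure $J$, then $\psi=A\circ\varphi_F$ for an affine transformation $A$ of $\mathbb R^{2n+1}$ with $|\det A|=1$, and $\det A=1$ if the orientation is the same as for $\varphi_F$. -/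

import Mathlib

open scoped Manifold ContDiff Topology

noncomputable section

/-! ### Tensor calculus on a smooth manifold `M` modelled on a real vector space `V` -/

section General

variable {V : Type*} [NormedAddCommGroup V] [NormedSpace ℝ V]
  {M : Type*} [TopologicalSpace M] [ChartedSpace V M]

variable (V M) in
/-- (Not necessarily smooth) vector fields on `M`. -/
abbrev VField : Type _ := Π p : M, TangentSpace 𝓘(ℝ, V) p

variable (V M) in
/-- (Not necessarily smooth) fields of endomorphisms of the tangent spaces. -/
abbrev EndoField : Type _ :=
  Π p : M, TangentSpace 𝓘(ℝ, V) p →ₗ[ℝ] TangentSpace 𝓘(ℝ, V) p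

variable (V M) in
/-- (Not necessarily smooth) fields of bilinear forms on the tangent spaces. -/
abbrev BilinField : Type _ := Π p : M, LinearMap.BilinForm ℝ (TangentSpace 𝓘(ℝ, V) p)

variable (V M) in
/-- (Not necessarily smooth) differential forms of degree `m`. -/
abbrev FormField (m : ℕ) : Type _ := Π p : M, (TangentSpace 𝓘(ℝ, V) p) [⋀^Fin m]→ₗ[ℝ] ℝ

variable (V M) in
/-- Connections on the tangent bundle; `∇_v Y` at `p` is `D Y p v`. -/
abbrev Connection [IsManifold 𝓘(ℝ, V) ∞ M] : Type _ :=
  CovariantDerivative 𝓘(ℝ, V) V (fun p : M ↦ TangentSpace 𝓘(ℝ, V) p)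

/-- The vector field `X` is smooth at `p`. -/
def VField.SmoothAt [IsManifold 𝓘(ℝ, V) ∞ M] (X : VField V M) (p : M) : Prop :=
  ContMDiffAt 𝓘(ℝ, V) 𝓘(ℝ, V).tangent ∞ (fun q ↦ (⟨q, X q⟩ : TangentBundle 𝓘(ℝ, V) M)) p

/-- The derivative `df_p(v)` of a function `f : M → W` in the direction of `v ∈ T_pM`. -/
def dirDeriv {W : Type*} [NormedAddCommGroup W] [NormedSpace ℝ W] (f : M → W) (p : M)
    (v : TangentSpace 𝓘(ℝ, V) p) : W :=
  mvfderiv 𝓘(ℝ, V) f p v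

variable [IsManifold 𝓘(ℝ, V) ∞ M]

/-- `h` is an affine function for the connection `D`, i.e. `∇ dh = 0`. -/
def IsAffineFunction (D : Connection V M) (h : M → ℝ) : Prop :=
  ∀ (p : M) (v : TangentSpace 𝓘(ℝ, V) p) (Y : VField V M), Y.SmoothAt p →
    dirDeriv (fun q ↦ dirDeriv h q (Y q)) p v = dirDeriv h p (D Y p v)

/-- The connection is flat:
`∇_X ∇_Y Z - ∇_Y ∇_X Z - ∇_[X,Y] Z = 0`. -/
def IsFlatConnection (D : Connection V M) : Prop :=
  ∀ (p : M) (X Y Z : VField V M), X.SmoothAt p → Y.SmoothAt p → Z.SmoothAt p →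
    D (fun q ↦ D Z q (Y q)) p (X p) - D (fun q ↦ D Z q (X q)) p (Y p)
      - D Z p (VectorField.mlieBracket 𝓘(ℝ, V) X Y p) = 0

/-- The bilinear form `β` is `D`-parallel: `X (β(Y,Z)) = β(∇_X Y, Z) + β(Y, ∇_X Z)`. -/
def IsParallelBilin (D : Connection V M) (β : BilinField V M) : Prop :=
  ∀ (p : M) (v : TangentSpace 𝓘(ℝ, V) p) (Y Z : VField V M), Y.SmoothAt p → Z.SmoothAt p →
    dirDeriv (fun q ↦ β q (Y q) (Z q)) p v = β p (D Y p v) (Z p) + β p (Y p) (D Z p v)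

/-- The `m`-form `ν` is `D`-parallel. -/
def IsParallelForm {m : ℕ} (D : Connection V M) (ν : FormField V M m) : Prop :=
  ∀ (p : M) (v : TangentSpace 𝓘(ℝ, V) p) (Y : Fin m → VField V M), (∀ i, (Y i).SmoothAt p) →
    dirDeriv (fun q ↦ ν q (fun i ↦ Y i q)) p v
      = ∑ i, ν p (Function.update (fun j ↦ Y j p) i (D (Y i) p v))

/-- The 2-form `β` is closed: `dβ(X,Y,Z) = 0` for all `X, Y, Z`. -/
def IsClosedTwoForm (β : BilinField V M) : Prop :=
  ∀ (p : M) (X Y Z : VField V M), X.SmoothAt p → Y.SmoothAt p → Z.SmoothAt p →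
    dirDeriv (fun q ↦ β q (Y q) (Z q)) p (X p)
      - dirDeriv (fun q ↦ β q (X q) (Z q)) p (Y p)
      + dirDeriv (fun q ↦ β q (X q) (Y q)) p (Z p)
      - β p (VectorField.mlieBracket 𝓘(ℝ, V) X Y p) (Z p)
      + β p (VectorField.mlieBracket 𝓘(ℝ, V) X Z p) (Y p)
      - β p (VectorField.mlieBracket 𝓘(ℝ, V) Y Z p) (X p) = 0

/-- `g` is a smooth pseudo-Riemannian metric. -/
structure IsPseudoMetric (g : BilinField V M) : Prop where
  smooth : ∀ (p : M) (X Y : VField V M), X.SmoothAt p → Y.SmoothAt p →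
    ContMDiffAt 𝓘(ℝ, V) 𝓘(ℝ, ℝ) ∞ (fun q ↦ g q (X q) (Y q)) p
  symm : ∀ (p : M) (v w : TangentSpace 𝓘(ℝ, V) p), g p v w = g p w v
  nondegenerate : ∀ p : M, (g p).Nondegenerate

/-- `J` is a smooth almost complex structure. -/
structure IsAlmostComplex (J : EndoField V M) : Prop where
  smooth : ∀ (p : M) (X : VField V M), X.SmoothAt p →
    VField.SmoothAt (fun q ↦ J q (X q)) p
  sq : ∀ (p : M) (v : TangentSpace 𝓘(ℝ, V) p), J p (J p v) = -v

/-- The almost complex structure `J` is integrable: around each point there is a smooth chart into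
some `ℂᵏ` whose differential intertwines `J` with the multiplication by `i`. -/
def IsIntegrableComplex (J : EndoField V M) : Prop :=
  ∀ p : M, ∃ (k : ℕ) (ψ : OpenPartialHomeomorph M (Fin k → ℂ)), p ∈ ψ.source ∧
    ContMDiffOn 𝓘(ℝ, V) 𝓘(ℝ, Fin k → ℂ) ∞ ψ ψ.source ∧
    ContMDiffOn 𝓘(ℝ, Fin k → ℂ) 𝓘(ℝ, V) ∞ ψ.symm ψ.target ∧
    ∀ q ∈ ψ.source, ∀ v : TangentSpace 𝓘(ℝ, V) q,
      dirDeriv ψ q (J q v) = Complex.I • dirDeriv ψ q v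

/-- The bilinear form `ω = g(J·,·)`. -/
def fundamentalForm (J : EndoField V M) (g : BilinField V M) : BilinField V M :=
  fun p ↦ (g p).comp (J p) LinearMap.id

/-- `(M, J, g)` is a pseudo-Kähler manifold. -/
structure IsPseudoKaehler (J : EndoField V M) (g : BilinField V M) : Prop where
  almostComplex : IsAlmostComplex J
  integrable : IsIntegrableComplex J
  metric : IsPseudoMetric g
  hermitian : ∀ (p : M) (v w : TangentSpace 𝓘(ℝ, V) p), g p (J p v) (J p w) = g p v w
  closed : IsClosedTwoForm (fundamentalForm J g)

/-- `(M, J, g, ∇)` is a special Kähler manifold. -/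
structure IsSpecialKaehler [CompleteSpace V] [FiniteDimensional ℝ V]
    (J : EndoField V M) (g : BilinField V M) (D : Connection V M) : Prop where
  pseudoKaehler : IsPseudoKaehler J g
  smooth : D.ContMDiffCovariantDerivative ∞
  torsionFree : D.torsion = 0
  flat : IsFlatConnection D
  /-- `∇J` is symmetric: `(∇_X J) Y = (∇_Y J) X`, with `(∇_X J) Y = ∇_X (J Y) - J (∇_X Y)`. -/
  nablaJ_symm : ∀ (p : M) (X Y : VField V M), X.SmoothAt p → Y.SmoothAt p →
    D (fun q ↦ J q (Y q)) p (X p) - J p (D Y p (X p))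
      = D (fun q ↦ J q (X q)) p (Y p) - J p (D X p (Y p))
  parallel : IsParallelBilin D (fundamentalForm J g)

/-! ### Affine hypersurfaces -/

variable (V M) in
/-- An orientation of the `m`-dimensional manifold `M`: an orientation of each tangent space which
near each point is given by a smooth local frame. -/
@[ext]
structure ManifoldOrientation (m : ℕ) where
  /-- The orientation of the tangent space at `p`. -/
  at_ : Π p : M, Orientation ℝ (TangentSpace 𝓘(ℝ, V) p) (Fin m)
  exists_frame : ∀ p : M, ∃ Y : Fin m → VField V M, (∀ i, (Y i).SmoothAt p) ∧
    ∀ᶠ q in 𝓝 p, ∃ b : Module.Basis (Fin m) ℝ (TangentSpace 𝓘(ℝ, V) q),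
      (∀ i, b i = Y i q) ∧ b.orientation = at_ q

/-- `ν` is the volume form of the pseudo-Riemannian metric `g` on the oriented manifold `M`. -/
def IsMetricVolumeForm {m : ℕ} (o : ManifoldOrientation V M m) (g : BilinField V M)
    (ν : FormField V M m) : Prop :=
  ∀ (p : M) (b : Module.Basis (Fin m) ℝ (TangentSpace 𝓘(ℝ, V) p)), b.orientation = o.at_ p →
    ν p b = √|(Matrix.of fun i j ↦ g p (b i) (b j)).det|

/-- The form `ν = vol(ξ, …)` induced on `M` by a vector field `ξ` along `φ : M → ℝ^{m+1}`. -/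
def inducedForm {m : ℕ} (vol : (Fin (m + 1) → ℝ) [⋀^Fin (m + 1)]→ₗ[ℝ] ℝ)
    (φ ξ : M → Fin (m + 1) → ℝ) : FormField V M m :=
  fun p ↦ (vol.curryLeft (ξ p)).compLinearMap (mvfderiv 𝓘(ℝ, V) φ p).toLinearMap

/-- `φ : M → ℝ^{m+1}` is an immersed hypersurface of the affine space `ℝ^{m+1}` with parallel volume
form `vol`, which has the affine normal `ξ` (with respect to the orientation `o` of `M`), the
Blaschke metric `g` and the induced connection `D`. -/
structure IsBlaschkeHypersurface {m : ℕ} (vol : (Fin (m + 1) → ℝ) [⋀^Fin (m + 1)]→ₗ[ℝ] ℝ)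
    (o : ManifoldOrientation V M m) (φ ξ : M → Fin (m + 1) → ℝ)
    (g : BilinField V M) (D : Connection V M) : Prop where
  one_lt : 1 < m
  finrank_eq : Module.finrank ℝ V = m
  smooth : ContMDiff 𝓘(ℝ, V) 𝓘(ℝ, Fin (m + 1) → ℝ) ∞ φ
  immersion : ∀ p : M, Function.Injective (mvfderiv 𝓘(ℝ, V) φ p)
  smooth_normal : ContMDiff 𝓘(ℝ, V) 𝓘(ℝ, Fin (m + 1) → ℝ) ∞ ξ
  transversal : ∀ p : M, ξ p ∉ Set.range (mvfderiv 𝓘(ℝ, V) φ p)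
  /-- The Gauss equation `∇̃_X (φ_* Y) = φ_* (∇_X Y) + g(X, Y) ξ`. -/
  gauss : ∀ (p : M) (v : TangentSpace 𝓘(ℝ, V) p) (Y : VField V M), Y.SmoothAt p →
    dirDeriv (fun q ↦ dirDeriv φ q (Y q)) p v = dirDeriv φ p (D Y p v) + g p v (Y p) • ξ p
  metric : IsPseudoMetric g
  volume_eq : IsMetricVolumeForm o g (inducedForm vol φ ξ)
  volume_parallel : IsParallelForm D (inducedForm (V := V) vol φ ξ)

/-- `J` is an almost complex structure compatible with the data `(g, D)` of a hypersurface. -/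
structure IsCompatibleComplex (J : EndoField V M) (g : BilinField V M) (D : Connection V M) :
    Prop where
  almostComplex : IsAlmostComplex J
  skew : ∀ (p : M) (v w : TangentSpace 𝓘(ℝ, V) p), g p (J p v) w = -g p v (J p w)
  parallel : IsParallelBilin D (fundamentalForm J g)

/-- `φ` is a special parabolic affine hypersphere with affine normal `ξ`, Blaschke metric `g`,
induced connection `D` and compatible almost complex structure `J`. -/
structure IsSpecialParabolicHypersphere {m : ℕ}
    (vol : (Fin (m + 1) → ℝ) [⋀^Fin (m + 1)]→ₗ[ℝ] ℝ) (o : ManifoldOrientation V M m)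
    (φ ξ : M → Fin (m + 1) → ℝ) (g : BilinField V M) (D : Connection V M)
    (J : EndoField V M) : Prop where
  blaschke : IsBlaschkeHypersurface vol o φ ξ g D
  parabolic : ∀ (p : M) (v : TangentSpace 𝓘(ℝ, V) p), dirDeriv ξ p v = 0
  compatible : IsCompatibleComplex J g D

end General

/-! ### Riemann domains and the special Kähler data defined by a holomorphic function -/

section RiemannDomain

variable {n : ℕ} {M : Type*} [TopologicalSpace M] [ChartedSpace (Fin n → ℂ) M]

/-- A complex manifold is a smooth manifold. -/
instance isManifold_real_of_complex [IsManifold 𝓘(ℂ, Fin n → ℂ) ω M] :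
    IsManifold 𝓘(ℝ, Fin n → ℂ) ∞ M := by
  apply isManifold_of_contDiffOn
  intro e e' he he'
  have h := (contDiffGroupoid ω 𝓘(ℂ, Fin n → ℂ)).compatible he he'
  have h1 := (mem_groupoid_of_pregroupoid.1 h).1
  exact (h1.restrict_scalars ℝ).of_le le_top

/-- `π : M → U` is a Riemann domain over the domain `U ⊆ ℂⁿ`: a covering which is locally
biholomorphic. -/
structure IsRiemannDomain (U : Set (Fin n → ℂ)) (π : M → Fin n → ℂ) : Prop where
  isOpen : IsOpen U
  isConnected : IsConnected U
  mapsTo : ∀ p, π p ∈ U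
  covering : IsCoveringMap (Set.codRestrict π U mapsTo)
  unramified : IsLocalDiffeomorph 𝓘(ℂ, Fin n → ℂ) 𝓘(ℂ, Fin n → ℂ) ω π

/-- The partial derivative `∂h/∂z̃ʲ` of a holomorphic function `h` on `M` with respect to the local
holomorphic coordinates given by the components of `π`. -/
def partialDeriv (π : M → Fin n → ℂ) (h : M → ℂ) (j : Fin n) (p : M) : ℂ :=
  mvfderiv 𝓘(ℂ, Fin n → ℂ) h p ((mvfderiv 𝓘(ℂ, Fin n → ℂ) π p).inverse (Pi.single j 1))

/-- `F` is nondegenerate: the real matrix `Im ∂²F` is everywhere invertible. -/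
def IsNondegenerate (π : M → Fin n → ℂ) (F : M → ℂ) : Prop :=
  ∀ p : M, IsUnit (Matrix.of fun i j ↦ (partialDeriv π (partialDeriv π F j) i p).im)

/-- The Lagrangian immersion `p ↦ dF ∘ (π_* |_p)⁻¹` into `T*ℂⁿ = ℂⁿ × ℂⁿ`, in the canonical
coordinates `(z, w)`. -/
def lagrangianMap (π : M → Fin n → ℂ) (F : M → ℂ) (p : M) : (Fin n → ℂ) × (Fin n → ℂ) :=
  (π p, fun j ↦ partialDeriv π F j p)

/-- The standard complex symplectic form `Ω = ∑ dzⁱ ∧ dwᵢ` of `T*ℂⁿ`. -/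
def symplecticForm (a b : (Fin n → ℂ) × (Fin n → ℂ)) : ℂ :=
  ∑ i, (a.1 i * b.2 i - b.1 i * a.2 i)

/-- The Hermitian form `γ = √-1 Ω(·, conj ·)` of `T*ℂⁿ`. -/
def hermitianForm (a b : (Fin n → ℂ) × (Fin n → ℂ)) : ℂ :=
  Complex.I * symplecticForm a (star b)

/-- The complex structure of the complex manifold `M`, as a field of endomorphisms. -/
def complexStructure : EndoField (Fin n → ℂ) M :=
  fun _ ↦ (Complex.I • LinearMap.id : (Fin n → ℂ) →ₗ[ℝ] (Fin n → ℂ))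

/-- The tensor field `g = Re φ^*γ` for the Lagrangian immersion `φ`. -/
def specialMetric (π : M → Fin n → ℂ) (F : M → ℂ) : BilinField (Fin n → ℂ) M :=
  fun p ↦ LinearMap.mk₂ ℝ
    (fun v w ↦ (hermitianForm (dirDeriv (lagrangianMap π F) p v)
      (dirDeriv (lagrangianMap π F) p w)).re)
    (fun v v' w ↦ by
      simp only [hermitianForm, symplecticForm, dirDeriv, map_add, Prod.fst_add, Prod.snd_add,
        Pi.add_apply, ← Complex.add_re, ← mul_add, ← Finset.sum_add_distrib]
      congr 2
      exact Finset.sum_congr rfl fun i _ ↦ by ring)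
    (fun c v w ↦ by
      simp only [hermitianForm, symplecticForm, dirDeriv, map_smul, Prod.smul_fst, Prod.smul_snd,
        Pi.smul_apply, ← Complex.smul_re, Complex.real_smul, Finset.mul_sum]
      congr 1
      exact Finset.sum_congr rfl fun i _ ↦ by ring)
    (fun v w w' ↦ by
      simp only [hermitianForm, symplecticForm, dirDeriv, map_add, Prod.fst_add, Prod.snd_add,
        star_add, Pi.add_apply, ← Complex.add_re, ← mul_add, ← Finset.sum_add_distrib]
      congr 2
      exact Finset.sum_congr rfl fun i _ ↦ by ring)
    (fun c v w ↦ by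
      simp only [hermitianForm, symplecticForm, dirDeriv, map_smul, star_smul, Prod.smul_fst,
        Prod.smul_snd, star_trivial, Pi.smul_apply, ← Complex.smul_re, Complex.real_smul,
        Finset.mul_sum]
      congr 1
      exact Finset.sum_congr rfl fun i _ ↦ by ring)

/-- `x̃ⁱ = Re z̃ⁱ`. -/
def xCoord (π : M → Fin n → ℂ) (i : Fin n) (p : M) : ℝ := (π p i).re

/-- `ỹⱼ = Re w̃ⱼ = Re ∂F/∂z̃ʲ`. -/
def yCoord (π : M → Fin n → ℂ) (F : M → ℂ) (j : Fin n) (p : M) : ℝ := (partialDeriv π F j p).re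

/-- The map `φ_F = (Re z̃, Re F_z̃, 2 Im F - 2 (Re F_z̃) Im z̃)`. -/
def phiF (π : M → Fin n → ℂ) (F : M → ℂ) (p : M) : Fin (n + n + 1) → ℝ :=
  Fin.snoc (α := fun _ ↦ ℝ)
    (Fin.append (fun i ↦ (π p i).re) (fun j ↦ (partialDeriv π F j p).re))
    (2 * (F p).im - 2 * ∑ k, (partialDeriv π F k p).re * (π p k).im)

/-- The volume form `2ⁿ det` of `ℝ^{2n+1}`. -/
def standardVol (n : ℕ) : (Fin (n + n + 1) → ℝ) [⋀^Fin (n + n + 1)]→ₗ[ℝ] ℝ :=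
  (2 : ℝ) ^ n • (Pi.basisFun ℝ (Fin (n + n + 1))).det

end RiemannDomain

end

/-! Put Φ = (x̃, ỹ) (`affineCoords`), Ψ = (-Im z̃, -Im w̃) (`conjCoords`), and let σ be the standard
symplectic form of ℝ²ⁿ. Everything is read off from Φ, Ψ and σ.

Nondegeneracy of F makes dΦ invertible (`isDevelopingMap_affineCoords`), so the flat connection of
ℝ²ⁿ pulls back along Φ to ∇. Every tensor with constant coefficients in Φ is ∇-parallel. Since J
multiplies dz̃ and dw̃ by i, one has dΦ ∘ J = dΨ. As (z̃, w̃) is Lagrangian, g(v, Ju) = 2σ(dΦ v, dΦ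
u) (`specialMetric_complexStructure`). Hence the Kähler form is parallel, and closed because ∇ is
torsion-free. The symmetry of ∇J is the identity X(YΨ) - Y(XΨ) = [X,Y]Ψ.

The last coordinate h of φ_F satisfies dh = 2σ(Ψ, dΦ) (`dirDeriv_height`). So its ∇-Hessian is
2σ(dΨ, dΦ) = g, which is the Gauss equation with ξ = ∂_{2n+1}. In the frame of Φ the Gram matrix of
g is twice a product of two matrices of determinant ±1, which accounts for the factor 2ⁿ in the
volume form (`abs_det_specialMetric`).

For uniqueness, a linear map A is chosen to match ξ and the differentials of the two hypersurfaces
at one point. By the two Gauss equations ψ - A ∘ φ has zero ∇-Hessian, hence is constant, and the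
volume normalization gives |det A| = 1. -/

noncomputable section

set_option linter.unusedSectionVars false

/-! ### Directional derivatives and Lie brackets, computed in charts. -/

section Calculus

variable {V : Type*} [NormedAddCommGroup V] [NormedSpace ℝ V]
  {M : Type*} [TopologicalSpace M] [ChartedSpace V M]
  {W : Type*} [NormedAddCommGroup W] [NormedSpace ℝ W]
  {W' : Type*} [NormedAddCommGroup W'] [NormedSpace ℝ W']

/-- The representative of a vector field in the preferred chart at `p`. -/
def chartField (p : M) (X : VField V M) (e : V) : V :=
  (mfderiv 𝓘(ℝ, V) 𝓘(ℝ, V) (extChartAt 𝓘(ℝ, V) p).symm e).inverse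
    (X ((extChartAt 𝓘(ℝ, V) p).symm e))

lemma chartField_eq (p : M) (X : VField V M) :
    chartField p X = VectorField.mpullbackWithin 𝓘(ℝ, V) 𝓘(ℝ, V) (extChartAt 𝓘(ℝ, V) p).symm X
      (Set.range 𝓘(ℝ, V)) := by
  ext e
  simp only [chartField, VectorField.mpullbackWithin, modelWithCornersSelf_coe, Set.range_id,
    mfderivWithin_univ]
  rfl

lemma dirDeriv_map_sub (f : M → W) (p : M) (v w : TangentSpace 𝓘(ℝ, V) p) :
    dirDeriv f p (v - w) = dirDeriv f p v - dirDeriv f p w := map_sub (mvfderiv 𝓘(ℝ, V) f p) v w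

lemma dirDeriv_map_neg (f : M → W) (p : M) (v : TangentSpace 𝓘(ℝ, V) p) :
    dirDeriv f p (-v) = -dirDeriv f p v := map_neg (mvfderiv 𝓘(ℝ, V) f p) v

lemma dirDeriv_map_smul (f : M → W) (p : M) (c : ℝ) (v : TangentSpace 𝓘(ℝ, V) p) :
    dirDeriv f p (c • v) = c • dirDeriv f p v := map_smul (mvfderiv 𝓘(ℝ, V) f p) c v

lemma dirDeriv_map_zero (f : M → W) (p : M) :
    dirDeriv f p (0 : TangentSpace 𝓘(ℝ, V) p) = 0 := map_zero (mvfderiv 𝓘(ℝ, V) f p)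

lemma dirDeriv_map_sum (f : M → W) (p : M) {ι : Type*} (s : Finset ι)
    (v : ι → TangentSpace 𝓘(ℝ, V) p) :
    dirDeriv f p (∑ i ∈ s, v i) = ∑ i ∈ s, dirDeriv f p (v i) :=
  map_sum (mvfderiv 𝓘(ℝ, V) f p) v s

lemma dirDeriv_clm_comp (ℓ : W →L[ℝ] W') {f : M → W} {p : M}
    (hf : MDifferentiableAt 𝓘(ℝ, V) 𝓘(ℝ, W) f p) (v : TangentSpace 𝓘(ℝ, V) p) :
    dirDeriv (fun q ↦ ℓ (f q)) p v = ℓ (dirDeriv f p v) := by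
  have h := mfderiv_comp_apply (I' := 𝓘(ℝ, W)) p ℓ.mdifferentiableAt hf v
  rw [ℓ.mfderiv_eq] at h
  exact h

lemma dirDeriv_comp_differentiableAt {G : W → W'} {f : M → W} {p : M}
    (hG : DifferentiableAt ℝ G (f p)) (hf : MDifferentiableAt 𝓘(ℝ, V) 𝓘(ℝ, W) f p)
    (v : TangentSpace 𝓘(ℝ, V) p) :
    dirDeriv (fun q ↦ G (f q)) p v = fderiv ℝ G (f p) (dirDeriv f p v) := by
  have h := mfderiv_comp_apply (I' := 𝓘(ℝ, W)) p hG.mdifferentiableAt hf v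
  rw [mfderiv_eq_fderiv] at h
  exact h

lemma dirDeriv_bilin {W'' : Type*} [NormedAddCommGroup W''] [NormedSpace ℝ W'']
    (B : W →L[ℝ] W' →L[ℝ] W'') {f : M → W} {g : M → W'} {p : M}
    (hf : MDifferentiableAt 𝓘(ℝ, V) 𝓘(ℝ, W) f p) (hg : MDifferentiableAt 𝓘(ℝ, V) 𝓘(ℝ, W') g p)
    (v : TangentSpace 𝓘(ℝ, V) p) :
    dirDeriv (fun q ↦ B (f q) (g q)) p v = B (dirDeriv f p v) (g p) + B (f p) (dirDeriv g p v) := by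
  have h1 := dirDeriv_comp_differentiableAt (f := fun q ↦ (f q, g q))
    (G := fun a : W × W' ↦ B a.1 a.2) (B.isBoundedBilinearMap.differentiableAt _)
    (hf.prodMk_space hg) v
  have h2 : dirDeriv (fun q ↦ (f q, g q)) p v = (dirDeriv f p v, dirDeriv g p v) :=
    Prod.ext (dirDeriv_clm_comp (ContinuousLinearMap.fst ℝ W W') (hf.prodMk_space hg) v).symm
      (dirDeriv_clm_comp (ContinuousLinearMap.snd ℝ W W') (hf.prodMk_space hg) v).symm
  rw [B.isBoundedBilinearMap.fderiv, h2] at h1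
  exact h1.trans (add_comm _ _)

lemma dirDeriv_apply {ι : Type*} [Fintype ι] {f : M → ι → W} {p : M}
    (hf : MDifferentiableAt 𝓘(ℝ, V) 𝓘(ℝ, ι → W) f p) (v : TangentSpace 𝓘(ℝ, V) p) (i : ι) :
    dirDeriv f p v i = dirDeriv (fun q ↦ f q i) p v :=
  (dirDeriv_clm_comp (ContinuousLinearMap.proj (R := ℝ) (φ := fun _ : ι ↦ W) i) hf v).symm

lemma dirDeriv_fun_add {f g : M → W} {p : M} (hf : MDifferentiableAt 𝓘(ℝ, V) 𝓘(ℝ, W) f p)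
    (hg : MDifferentiableAt 𝓘(ℝ, V) 𝓘(ℝ, W) g p) (v : TangentSpace 𝓘(ℝ, V) p) :
    dirDeriv (fun q ↦ f q + g q) p v = dirDeriv f p v + dirDeriv g p v := by
  simp only [dirDeriv, mvfderiv_fun_add hf hg]
  rfl

lemma dirDeriv_fun_sub {f g : M → W} {p : M} (hf : MDifferentiableAt 𝓘(ℝ, V) 𝓘(ℝ, W) f p)
    (hg : MDifferentiableAt 𝓘(ℝ, V) 𝓘(ℝ, W) g p) (v : TangentSpace 𝓘(ℝ, V) p) :
    dirDeriv (fun q ↦ f q - g q) p v = dirDeriv f p v - dirDeriv g p v := by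
  simp only [dirDeriv, mvfderiv_fun_sub hf hg]
  rfl

lemma dirDeriv_const (c : W) (p : M) (v : TangentSpace 𝓘(ℝ, V) p) :
    dirDeriv (fun _ ↦ c) p v = 0 := by
  simp only [dirDeriv, mvfderiv_const]
  rfl

lemma mdifferentiableAt_fun_sum {ι : Type*} {s : Finset ι} {f : ι → M → W} {p : M}
    (hf : ∀ i ∈ s, MDifferentiableAt 𝓘(ℝ, V) 𝓘(ℝ, W) (f i) p) :
    MDifferentiableAt 𝓘(ℝ, V) 𝓘(ℝ, W) (fun q ↦ ∑ i ∈ s, f i q) p := by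
  classical
  induction s using Finset.induction_on with
  | empty => simpa using mdifferentiableAt_const
  | insert a s ha ih =>
    simp only [Finset.sum_insert ha]
    exact (hf a (by simp)).add (ih fun i hi ↦ hf i (by simp [hi]))

lemma dirDeriv_fun_sum {ι : Type*} {s : Finset ι} {f : ι → M → W} {p : M}
    (hf : ∀ i ∈ s, MDifferentiableAt 𝓘(ℝ, V) 𝓘(ℝ, W) (f i) p) (v : TangentSpace 𝓘(ℝ, V) p) :
    dirDeriv (fun q ↦ ∑ i ∈ s, f i q) p v = ∑ i ∈ s, dirDeriv (f i) p v := by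
  classical
  induction s using Finset.induction_on with
  | empty => simpa using dirDeriv_const (0 : W) p v
  | insert a s ha ih =>
    have hs : ∀ i ∈ s, MDifferentiableAt 𝓘(ℝ, V) 𝓘(ℝ, W) (f i) p := fun i hi ↦ hf i (by simp [hi])
    simp only [Finset.sum_insert ha]
    rw [dirDeriv_fun_add (hf a (by simp)) (mdifferentiableAt_fun_sum hs), ih hs]

lemma dirDeriv_fun_mul {A : Type*} [NormedRing A] [NormedAlgebra ℝ A] {f g : M → A} {p : M}
    (hf : MDifferentiableAt 𝓘(ℝ, V) 𝓘(ℝ, A) f p) (hg : MDifferentiableAt 𝓘(ℝ, V) 𝓘(ℝ, A) g p)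
    (v : TangentSpace 𝓘(ℝ, V) p) :
    dirDeriv (fun q ↦ f q * g q) p v = f p * dirDeriv g p v + dirDeriv f p v * g p := by
  have h := (hf.hasMFDerivAt.mul' hg.hasMFDerivAt).mfderiv
  exact DFunLike.congr_fun h v

lemma mdifferentiableAt_fun_mul {A : Type*} [NormedRing A] [NormedAlgebra ℝ A] {f g : M → A}
    {p : M} (hf : MDifferentiableAt 𝓘(ℝ, V) 𝓘(ℝ, A) f p)
    (hg : MDifferentiableAt 𝓘(ℝ, V) 𝓘(ℝ, A) g p) :
    MDifferentiableAt 𝓘(ℝ, V) 𝓘(ℝ, A) (fun q ↦ f q * g q) p :=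
  hf.mul hg

lemma contDiffAt_comp_chart_symm {f : M → W} {p : M} {m : WithTop ℕ∞}
    (hf : ContMDiffAt 𝓘(ℝ, V) 𝓘(ℝ, W) m f p) :
    ContDiffAt ℝ m (f ∘ (extChartAt 𝓘(ℝ, V) p).symm) (extChartAt 𝓘(ℝ, V) p p) := by
  have h := (contMDiffAt_iff.1 hf).2
  simpa only [modelWithCornersSelf_coe, Set.range_id, contDiffWithinAt_univ,
    extChartAt_model_space_eq_id,
    PartialEquiv.refl_coe, Function.id_comp] using h

lemma dirDeriv_eq_fderiv_chart {f : M → W} {p : M}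
    (hf : MDifferentiableAt 𝓘(ℝ, V) 𝓘(ℝ, W) f p) (v : TangentSpace 𝓘(ℝ, V) p) :
    dirDeriv f p v
      = fderiv ℝ (f ∘ (extChartAt 𝓘(ℝ, V) p).symm) (extChartAt 𝓘(ℝ, V) p p) v := by
  rw [dirDeriv, hf.mvfderiv]
  simp only [modelWithCornersSelf_coe, Set.range_id, fderivWithin_univ, writtenInExtChartAt,
    extChartAt_model_space_eq_id, PartialEquiv.refl_coe, Function.id_comp]
  rfl

/-- The terms containing the second derivative of `f` cancel by its symmetry; those differentiating
the fields form the bracket. -/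
lemma fderiv_fderiv_sub_eq_lieBracket {f : V → W} {x : V} {X Y : V → V}
    (hf : ContDiffAt ℝ 2 f x) (hX : DifferentiableAt ℝ X x) (hY : DifferentiableAt ℝ Y x) :
    fderiv ℝ (fun e ↦ fderiv ℝ f e (Y e)) x (X x) - fderiv ℝ (fun e ↦ fderiv ℝ f e (X e)) x (Y x)
      = fderiv ℝ f x (VectorField.lieBracket ℝ X Y x) := by
  have hd : DifferentiableAt ℝ (fderiv ℝ f) x :=
    (hf.fderiv_right (m := 1) (by norm_num)).differentiableAt (by simp)
  have hs := (hf.isSymmSndFDerivAt (by simp)).eq (X x) (Y x)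
  rw [fderiv_clm_apply hd hX, fderiv_clm_apply hd hY, VectorField.lieBracket]
  simp [hs]

lemma contMDiffAt_of_comp_chart_symm {f : M → W} {p : M} {m : WithTop ℕ∞}
    [IsManifold 𝓘(ℝ, V) m M]
    (hf : ContDiffAt ℝ m (f ∘ (extChartAt 𝓘(ℝ, V) p).symm) (extChartAt 𝓘(ℝ, V) p p)) :
    ContMDiffAt 𝓘(ℝ, V) 𝓘(ℝ, W) m f p := by
  have h := hf.contMDiffAt.comp p (contMDiffAt_extChartAt (I := 𝓘(ℝ, V)))
  refine h.congr_of_eventuallyEq ?_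
  filter_upwards [extChartAt_source_mem_nhds (I := 𝓘(ℝ, V)) p] with q hq
  rw [Function.comp_apply, Function.comp_apply, (extChartAt 𝓘(ℝ, V) p).left_inv hq]

variable [IsManifold 𝓘(ℝ, V) ∞ M]

lemma dirDeriv_comp_chart {f : M → W} {p : M} (X : VField V M) {e : V}
    (he : e ∈ (extChartAt 𝓘(ℝ, V) p).target)
    (hf : MDifferentiableAt 𝓘(ℝ, V) 𝓘(ℝ, W) f ((extChartAt 𝓘(ℝ, V) p).symm e)) :
    dirDeriv f ((extChartAt 𝓘(ℝ, V) p).symm e) (X ((extChartAt 𝓘(ℝ, V) p).symm e))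
      = fderiv ℝ (f ∘ (extChartAt 𝓘(ℝ, V) p).symm) e (chartField p X e) := by
  have hinv := isInvertible_mfderivWithin_extChartAt_symm (I := 𝓘(ℝ, V)) he
  have : IsManifold 𝓘(ℝ, V) 1 M := .of_le (n := ∞) (by simp)
  have hsymm := mdifferentiableWithinAt_extChartAt_symm (I := 𝓘(ℝ, V)) he
  simp only [modelWithCornersSelf_coe, Set.range_id, mfderivWithin_univ,
    mdifferentiableWithinAt_univ] at hinv hsymm
  rw [← mfderiv_eq_fderiv, mfderiv_comp e hf hsymm]
  obtain ⟨A, hA⟩ := hinv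
  simp only [chartField, ← hA, ContinuousLinearMap.inverse_equiv]
  change _ = mfderiv 𝓘(ℝ, V) 𝓘(ℝ, W) f ((extChartAt 𝓘(ℝ, V) p).symm e) (A (A.symm _))
  rw [A.apply_symm_apply]
  rfl

lemma contDiffAt_chartField [CompleteSpace V] {p : M} {X : VField V M} (hX : X.SmoothAt p) :
    ContDiffAt ℝ ∞ (chartField p X) (extChartAt 𝓘(ℝ, V) p p) := by
  have h := VectorField.contMDiffWithinAt_mpullbackWithin_extChartAt_symm (n := ∞) (m := ∞)
    (s := Set.univ) (x := p) (V := X) (ContMDiffAt.contMDiffWithinAt hX) uniqueMDiffOn_univ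
    (Set.mem_univ p) (by simp)
  rw [← chartField_eq] at h
  have h2 := contMDiffWithinAt_vectorSpace_iff_contDiffWithinAt.1 h
  refine h2.contDiffAt ?_
  simpa using (extChartAt_target_mem_nhds (I := 𝓘(ℝ, V)) p)

/-- The tangent space at `p` is identified with `V` through the preferred chart at `p`, so that
chart has the identity as derivative at its own base point. -/
lemma mfderiv_extChartAt_self_inverse (p : M) (v : V) :
    (mfderiv 𝓘(ℝ, V) 𝓘(ℝ, V) (extChartAt 𝓘(ℝ, V) p) p).inverse v = v := by
  have : IsManifold 𝓘(ℝ, V) 1 M := .of_le (n := ∞) (by simp)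
  obtain ⟨A, hA⟩ := isInvertible_mfderiv_extChartAt (I := 𝓘(ℝ, V)) (mem_extChartAt_source p)
  rw [← hA, ContinuousLinearMap.inverse_equiv]
  have h := DFunLike.congr_fun (mfderiv_extChartAt_self (I := 𝓘(ℝ, V)) (x := p)) v
  rw [← hA] at h
  exact (A.symm_apply_eq).2 h.symm

lemma chartField_self {p : M} (X : VField V M) :
    chartField p X (extChartAt 𝓘(ℝ, V) p p) = X p := by
  have : IsManifold 𝓘(ℝ, V) 1 M := .of_le (n := ∞) (by simp)
  have h := VectorField.mfderiv_extChartAt_inverse_comp_mfderivWithin_extChartAT_symm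
    (I := 𝓘(ℝ, V)) (x := p) (X p)
  refine Eq.trans ?_ h
  refine Eq.trans ?_ (mfderiv_extChartAt_self_inverse p _).symm
  simp only [chartField, modelWithCornersSelf_coe, Set.range_id, mfderivWithin_univ]
  rw [extChartAt_to_inv]
  rfl

lemma mlieBracket_eq_chart {p : M} (X Y : VField V M) :
    VectorField.mlieBracket 𝓘(ℝ, V) X Y p
      = VectorField.lieBracket ℝ (chartField p X) (chartField p Y) (extChartAt 𝓘(ℝ, V) p p) := by
  rw [VectorField.mlieBracket, VectorField.mlieBracketWithin_apply, ← chartField_eq,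
    ← chartField_eq]
  simp only [modelWithCornersSelf_coe, Set.range_id, Set.preimage_univ, Set.inter_univ,
    VectorField.lieBracketWithin_univ]
  exact mfderiv_extChartAt_self_inverse p _

lemma eventually_mdifferentiableAt {f : M → W} {p : M}
    (hf : ContMDiffAt 𝓘(ℝ, V) 𝓘(ℝ, W) ∞ f p) :
    ∀ᶠ q in 𝓝 p, MDifferentiableAt 𝓘(ℝ, V) 𝓘(ℝ, W) f q := by
  have : IsManifold 𝓘(ℝ, V) 1 M := .of_le (n := ∞) (by simp)
  have h1 : ContMDiffAt 𝓘(ℝ, V) 𝓘(ℝ, W) 1 f p := hf.of_le (by simp)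
  filter_upwards [contMDiffAt_iff_contMDiffAt_nhds (by simp) |>.1 h1] with q hq
  exact hq.mdifferentiableAt one_ne_zero

lemma dirDeriv_comp_chart_eventuallyEq {f : M → W} {p : M} (X : VField V M)
    (hf : ContMDiffAt 𝓘(ℝ, V) 𝓘(ℝ, W) ∞ f p) :
    (fun q ↦ dirDeriv f q (X q)) ∘ (extChartAt 𝓘(ℝ, V) p).symm =ᶠ[𝓝 (extChartAt 𝓘(ℝ, V) p p)]
      fun e ↦ fderiv ℝ (f ∘ (extChartAt 𝓘(ℝ, V) p).symm) e (chartField p X e) := by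
  have hc : Filter.Tendsto (extChartAt 𝓘(ℝ, V) p).symm (𝓝 (extChartAt 𝓘(ℝ, V) p p)) (𝓝 p) := by
    simpa [ContinuousAt] using continuousAt_extChartAt_symm (I := 𝓘(ℝ, V)) p
  filter_upwards [hc.eventually (eventually_mdifferentiableAt hf),
    extChartAt_target_mem_nhds (I := 𝓘(ℝ, V)) p] with e he he'
  exact dirDeriv_comp_chart X he' he

/-- The derivative of a smooth function along a smooth vector field is smooth. -/
lemma contMDiffAt_dirDeriv [CompleteSpace V] {f : M → W} {p : M} {X : VField V M}
    (hf : ContMDiffAt 𝓘(ℝ, V) 𝓘(ℝ, W) ∞ f p) (hX : X.SmoothAt p) :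
    ContMDiffAt 𝓘(ℝ, V) 𝓘(ℝ, W) ∞ (fun q ↦ dirDeriv f q (X q)) p := by
  refine contMDiffAt_of_comp_chart_symm ?_
  refine ContDiffAt.congr_of_eventuallyEq ?_ (dirDeriv_comp_chart_eventuallyEq X hf)
  exact ((contDiffAt_comp_chart_symm hf).fderiv_right (by simp)).clm_apply
    (contDiffAt_chartField hX)

/-- The axioms of a covariant derivative quantify over merely differentiable sections, so this
version with a weaker hypothesis on `X` is needed to define a connection. -/
lemma mdifferentiableAt_dirDeriv [CompleteSpace V] {f : M → W} {p : M} {X : VField V M}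
    (hf : ContMDiffAt 𝓘(ℝ, V) 𝓘(ℝ, W) ∞ f p)
    (hX : MDifferentiableAt 𝓘(ℝ, V) 𝓘(ℝ, V).tangent
      (fun q ↦ (⟨q, X q⟩ : TangentBundle 𝓘(ℝ, V) M)) p) :
    MDifferentiableAt 𝓘(ℝ, V) 𝓘(ℝ, W) (fun q ↦ dirDeriv f q (X q)) p := by
  have : IsManifold 𝓘(ℝ, V) 2 M := .of_le (n := ∞) ENat.LEInfty.out
  have : IsManifold 𝓘(ℝ, V) 1 M := .of_le (n := ∞) (by simp)
  have h1 := hX.mdifferentiableWithinAt (s := Set.univ)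
    |>.differentiableWithinAt_mpullbackWithin_vectorField
  rw [← chartField_eq] at h1
  simp only [Set.preimage_univ, modelWithCornersSelf_coe, Set.range_id, Set.inter_univ,
    differentiableWithinAt_univ] at h1
  have h2 : ContDiffAt ℝ 2 (f ∘ (extChartAt 𝓘(ℝ, V) p).symm) (extChartAt 𝓘(ℝ, V) p p) :=
    (contDiffAt_comp_chart_symm hf).of_le ENat.LEInfty.out
  have hd := ((h2.fderiv_right (m := 1) (by norm_num)).differentiableAt (by simp)).clm_apply h1
  have hd' := hd.congr_of_eventuallyEq (dirDeriv_comp_chart_eventuallyEq X hf)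
  have h3 := hd'.comp_mdifferentiableAt (mdifferentiableAt_extChartAt (mem_chart_source V p))
  refine h3.congr_of_eventuallyEq ?_
  filter_upwards [extChartAt_source_mem_nhds (I := 𝓘(ℝ, V)) p] with q hq
  rw [Function.comp_apply, Function.comp_apply, (extChartAt 𝓘(ℝ, V) p).left_inv hq]

/-- `X (Y f) - Y (X f) = [X, Y] f`. -/
lemma dirDeriv_dirDeriv_sub [CompleteSpace V] {f : M → W} {p : M} {X Y : VField V M}
    (hf : ContMDiffAt 𝓘(ℝ, V) 𝓘(ℝ, W) ∞ f p) (hX : X.SmoothAt p) (hY : Y.SmoothAt p) :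
    dirDeriv (fun q ↦ dirDeriv f q (Y q)) p (X p) - dirDeriv (fun q ↦ dirDeriv f q (X q)) p (Y p)
      = dirDeriv f p (VectorField.mlieBracket 𝓘(ℝ, V) X Y p) := by
  have hfX := (contMDiffAt_dirDeriv hf hX).mdifferentiableAt (by simp)
  have hfY := (contMDiffAt_dirDeriv hf hY).mdifferentiableAt (by simp)
  have hf' := contDiffAt_comp_chart_symm hf
  have h2 : ContDiffAt ℝ 2 (f ∘ (extChartAt 𝓘(ℝ, V) p).symm) (extChartAt 𝓘(ℝ, V) p p) :=
    hf'.of_le ENat.LEInfty.out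
  have hX' := (contDiffAt_chartField hX).differentiableAt (by simp)
  have hY' := (contDiffAt_chartField hY).differentiableAt (by simp)
  rw [dirDeriv_eq_fderiv_chart hfX, dirDeriv_eq_fderiv_chart hfY,
    dirDeriv_eq_fderiv_chart (hf.mdifferentiableAt (by simp)),
    (dirDeriv_comp_chart_eventuallyEq X hf).fderiv_eq,
    (dirDeriv_comp_chart_eventuallyEq Y hf).fderiv_eq, mlieBracket_eq_chart]
  have h := fderiv_fderiv_sub_eq_lieBracket h2 hX' hY'
  rwa [chartField_self, chartField_self] at h

/-- A function with vanishing derivative on a connected manifold is constant. -/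
lemma eq_of_dirDeriv_eq_zero [ConnectedSpace M] {f : M → W}
    (hf : MDifferentiable 𝓘(ℝ, V) 𝓘(ℝ, W) f)
    (h : ∀ (p : M) (v : TangentSpace 𝓘(ℝ, V) p), dirDeriv f p v = 0) (p q : M) :
    f p = f q := by
  have hloc : IsLocallyConstant f := by
    rw [IsLocallyConstant.iff_eventually_eq]
    intro p
    set φ := extChartAt 𝓘(ℝ, V) p with hφ
    -- A ball in the chart target is convex, so there a vanishing derivative forces constancy.
    obtain ⟨r, hr, hball⟩ := Metric.mem_nhds_iff.1 (extChartAt_target_mem_nhds (I := 𝓘(ℝ, V)) p)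
    have : IsManifold 𝓘(ℝ, V) 1 M := .of_le (n := ∞) (by simp)
    have hsymm : ∀ e ∈ Metric.ball (φ p) r, MDifferentiableAt 𝓘(ℝ, V) 𝓘(ℝ, V) φ.symm e := by
      intro e he
      have := mdifferentiableWithinAt_extChartAt_symm (I := 𝓘(ℝ, V)) (hball he)
      simpa only [modelWithCornersSelf_coe, Set.range_id, mdifferentiableWithinAt_univ] using this
    have hconst : ∀ e ∈ Metric.ball (φ p) r, f (φ.symm e) = f (φ.symm (φ p)) := by
      intro e he
      refine Metric.isOpen_ball.is_const_of_fderiv_eq_zero (𝕜 := ℝ) (f := f ∘ φ.symm)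
        (convex_ball _ _).isPreconnected (fun x hx ↦ ?_) (fun x hx ↦ ?_) he
        (Metric.mem_ball_self hr)
      · exact ((hf _).comp x (hsymm x hx)).differentiableAt.differentiableWithinAt
      · rw [← mfderiv_eq_fderiv, mfderiv_comp x (hf _) (hsymm x hx)]
        have h0 : mfderiv 𝓘(ℝ, V) 𝓘(ℝ, W) f (φ.symm x) = 0 :=
          ContinuousLinearMap.ext fun v ↦ h _ v
        rw [h0, ContinuousLinearMap.zero_comp]
        rfl
    filter_upwards [(continuousAt_extChartAt (I := 𝓘(ℝ, V)) p).preimage_mem_nhds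
      (Metric.ball_mem_nhds _ hr), extChartAt_source_mem_nhds (I := 𝓘(ℝ, V)) p] with q hq hq'
    have h1 := hconst _ hq
    rwa [φ.left_inv hq', φ.left_inv (mem_extChartAt_source p)] at h1
  exact hloc.apply_eq_of_preconnectedSpace p q

end Calculus

/-! ### Developing maps and their flat connections. -/

section Developing

variable {V : Type*} [NormedAddCommGroup V] [NormedSpace ℝ V] [CompleteSpace V]
  {M : Type*} [TopologicalSpace M] [ChartedSpace V M] [IsManifold 𝓘(ℝ, V) ∞ M]
  {W : Type*} [NormedAddCommGroup W] [NormedSpace ℝ W] [FiniteDimensional ℝ W]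
  {W' : Type*} [NormedAddCommGroup W'] [NormedSpace ℝ W']

variable (V) in
/-- A smooth map to a vector space whose derivative is everywhere invertible. -/
structure IsDevelopingMap (Φ : M → W) : Prop where
  smooth : ContMDiff 𝓘(ℝ, V) 𝓘(ℝ, W) ∞ Φ
  invertible : ∀ p, (mvfderiv 𝓘(ℝ, V) Φ p).IsInvertible

variable (V) in
/-- The vector field which is mapped to the constant vector field `w` by a developing map. -/
def frameField (Φ : M → W) (w : W) : VField V M :=
  fun q ↦ (mvfderiv 𝓘(ℝ, V) Φ q).inverse w

namespace IsDevelopingMap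

variable {Φ : M → W}

lemma dirDeriv_inverse (hΦ : IsDevelopingMap V Φ) (p : M) (w : W) :
    dirDeriv Φ p ((mvfderiv 𝓘(ℝ, V) Φ p).inverse w) = w := by
  obtain ⟨A, hA⟩ := hΦ.invertible p
  rw [dirDeriv, ← hA, ContinuousLinearMap.inverse_equiv]
  exact A.apply_symm_apply w

lemma dirDeriv_frameField (hΦ : IsDevelopingMap V Φ) (p : M) (w : W) :
    dirDeriv Φ p (frameField V Φ w p) = w :=
  hΦ.dirDeriv_inverse p w

lemma inverse_dirDeriv (hΦ : IsDevelopingMap V Φ) (p : M) (v : TangentSpace 𝓘(ℝ, V) p) :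
    (mvfderiv 𝓘(ℝ, V) Φ p).inverse (dirDeriv Φ p v) = v := by
  obtain ⟨A, hA⟩ := hΦ.invertible p
  rw [dirDeriv, ← hA, ContinuousLinearMap.inverse_equiv]
  exact A.symm_apply_apply v

lemma frameField_dirDeriv (hΦ : IsDevelopingMap V Φ) (p : M) (v : TangentSpace 𝓘(ℝ, V) p) :
    frameField V Φ (dirDeriv Φ p v) p = v := hΦ.inverse_dirDeriv p v

lemma dirDeriv_injective (hΦ : IsDevelopingMap V Φ) (p : M) {v w : TangentSpace 𝓘(ℝ, V) p}
    (h : dirDeriv Φ p v = dirDeriv Φ p w) : v = w := by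
  rw [← hΦ.inverse_dirDeriv p v, h, hΦ.inverse_dirDeriv]

/-- The field is the pullback of a constant vector field along a map with invertible derivative. -/
lemma smoothAt_frameField (hΦ : IsDevelopingMap V Φ) (w : W) (p : M) :
    VField.SmoothAt (frameField V Φ w) p := by
  have : CompleteSpace W := FiniteDimensional.complete ℝ W
  have h1 : ContMDiffAt 𝓘(ℝ, W) 𝓘(ℝ, W).tangent ∞
      (fun q ↦ (⟨q, w⟩ : TangentBundle 𝓘(ℝ, W) W)) (Φ p) :=
    contMDiffAt_vectorSpace_iff_contDiffAt.2 contDiffAt_const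
  exact ContMDiffAt.mpullback_vectorField_preimage (V := fun _ ↦ w) h1 (hΦ.smooth p)
    (hΦ.invertible p) (by simp)

/-- For the converse, `Y` is expanded in the smooth frame of `Φ`; its coefficients are the
components of `dΦ(Y)`. -/
lemma smoothAt_iff (hΦ : IsDevelopingMap V Φ) {Y : VField V M} {p : M} :
    Y.SmoothAt p ↔ ContMDiffAt 𝓘(ℝ, V) 𝓘(ℝ, W) ∞ (fun q ↦ dirDeriv Φ q (Y q)) p := by
  refine ⟨fun h ↦ contMDiffAt_dirDeriv (hΦ.smooth p) h, fun h ↦ ?_⟩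
  let b := Module.finBasis ℝ W
  have hY : Y = fun q ↦ ∑ i, (b.repr (dirDeriv Φ q (Y q)) i) • frameField V Φ (b i) q := by
    ext q
    apply hΦ.dirDeriv_injective q
    conv_lhs => rw [← b.sum_repr (dirDeriv Φ q (Y q))]
    rw [dirDeriv_map_sum]
    refine Finset.sum_congr rfl fun i _ ↦ ?_
    rw [dirDeriv_map_smul, hΦ.dirDeriv_frameField]
  rw [hY]
  refine ContMDiffAt.sum_section fun i _ ↦ ?_
  refine ContMDiffAt.smul_section ?_ (hΦ.smoothAt_frameField (b i) p)
  exact (((LinearMap.toContinuousLinearMap (b.coord i)).contMDiff).contMDiffAt.comp p h)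

end IsDevelopingMap

/-- The flat connection for which the components of a developing map are affine functions. -/
def IsDevelopingMap.connection {Φ : M → W} (hΦ : IsDevelopingMap V Φ) : Connection V M where
  -- The connection is defined by dΦ(∇_v Y) = v(dΦ(Y)).
  toFun Y p := (mvfderiv 𝓘(ℝ, V) Φ p).inverse ∘L
    mvfderiv 𝓘(ℝ, V) (fun q ↦ dirDeriv Φ q (Y q)) p
  isCovariantDerivativeOnUniv :=
  { add := by
      intro Y Z p hY hZ _
      have hY' := mdifferentiableAt_dirDeriv (hΦ.smooth p) hY
      have hZ' := mdifferentiableAt_dirDeriv (hΦ.smooth p) hZ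
      have h : (fun q ↦ dirDeriv Φ q ((Y + Z) q))
          = fun q ↦ dirDeriv Φ q (Y q) + dirDeriv Φ q (Z q) :=
        funext fun q ↦ map_add (mvfderiv 𝓘(ℝ, V) Φ q) _ _
      rw [h, mvfderiv_fun_add hY' hZ', ContinuousLinearMap.comp_add]
    leibniz := by
      intro Y g p hY hg _
      have hY' := mdifferentiableAt_dirDeriv (hΦ.smooth p) hY
      have h : (fun q ↦ dirDeriv Φ q ((g • Y) q)) = fun q ↦ g q • dirDeriv Φ q (Y q) :=
        funext fun q ↦ map_smul (mvfderiv 𝓘(ℝ, V) Φ q) (g q) (Y q)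
      rw [h, mvfderiv_fun_smul hg hY', ContinuousLinearMap.comp_add,
        ContinuousLinearMap.comp_smul]
      congr 1
      ext v
      have h2 := hΦ.inverse_dirDeriv p (Y p)
      simp only [ContinuousLinearMap.comp_apply, ContinuousLinearMap.smulRight_apply,
        map_smul, h2] }

namespace IsDevelopingMap

variable {Φ : M → W} (hΦ : IsDevelopingMap V Φ)

lemma dirDeriv_connection (Y : VField V M) (p : M) (v : TangentSpace 𝓘(ℝ, V) p) :
    dirDeriv Φ p (hΦ.connection Y p v) = dirDeriv (fun q ↦ dirDeriv Φ q (Y q)) p v :=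
  hΦ.dirDeriv_inverse p _

lemma isAffineFunction (ℓ : W →L[ℝ] ℝ) : IsAffineFunction hΦ.connection (fun p ↦ ℓ (Φ p)) := by
  intro p v Y hY
  have h : (fun q ↦ dirDeriv (fun p ↦ ℓ (Φ p)) q (Y q)) = fun q ↦ ℓ (dirDeriv Φ q (Y q)) :=
    funext fun q ↦ dirDeriv_clm_comp ℓ ((hΦ.smooth q).mdifferentiableAt (by simp)) _
  rw [h, dirDeriv_clm_comp ℓ ((contMDiffAt_dirDeriv (hΦ.smooth p) hY).mdifferentiableAt (by simp)),
    dirDeriv_clm_comp ℓ ((hΦ.smooth p).mdifferentiableAt (by simp)), dirDeriv_connection]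

lemma connection_apply_smoothAt {X Y : VField V M} {p : M}
    (hX : X.SmoothAt p) (hY : Y.SmoothAt p) :
    VField.SmoothAt (fun q ↦ hΦ.connection Y q (X q)) p := by
  rw [hΦ.smoothAt_iff]
  simp only [dirDeriv_connection]
  exact contMDiffAt_dirDeriv (hΦ.smoothAt_iff.1 hY) hX

/-- After applying dΦ this is X(YΦ) - Y(XΦ) = [X,Y]Φ. -/
lemma connection_sub (X Y : VField V M) {p : M} (hX : X.SmoothAt p) (hY : Y.SmoothAt p) :
    hΦ.connection Y p (X p) - hΦ.connection X p (Y p) = VectorField.mlieBracket 𝓘(ℝ, V) X Y p := by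
  apply hΦ.dirDeriv_injective p
  rw [← dirDeriv_dirDeriv_sub (hΦ.smooth p) hX hY, dirDeriv, map_sub]
  exact congrArg₂ _ (hΦ.dirDeriv_connection _ _ _) (hΦ.dirDeriv_connection _ _ _)

lemma torsion_eq_zero [FiniteDimensional ℝ V] : hΦ.connection.torsion = 0 := by
  ext p v w
  -- Torsion is tensorial, so it can be evaluated on the frame fields that extend `v` and `w`.
  have h := hΦ.connection.torsion_apply
    ((hΦ.smoothAt_frameField (dirDeriv Φ p v) p).mdifferentiableAt (by simp))
    ((hΦ.smoothAt_frameField (dirDeriv Φ p w) p).mdifferentiableAt (by simp))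
  rw [connection_sub _ _ _ (hΦ.smoothAt_frameField _ p) (hΦ.smoothAt_frameField _ p), sub_self,
    hΦ.frameField_dirDeriv, hΦ.frameField_dirDeriv] at h
  exact h

lemma isFlatConnection : IsFlatConnection hΦ.connection := by
  intro p X Y Z hX hY hZ
  apply hΦ.dirDeriv_injective p
  have hLZ := contMDiffAt_dirDeriv (hΦ.smooth p) hZ
  -- Flatness is the commutator formula for the vector-valued function dΦ(Z), since dΦ turns ∇ into
  -- plain differentiation.
  have h := dirDeriv_dirDeriv_sub hLZ hX hY
  simp only [← hΦ.dirDeriv_connection Z] at h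
  rw [← hΦ.dirDeriv_connection, ← hΦ.dirDeriv_connection] at h
  rw [dirDeriv_map_sub, dirDeriv_map_sub, h, sub_self, dirDeriv_map_zero]

/-- In finite dimension a family of linear maps is the sum of its values on a basis tensored with
the dual basis. -/
lemma _root_.contMDiffAt_clm_of_apply {E : Type*} [NormedAddCommGroup E] [NormedSpace ℝ E]
    [FiniteDimensional ℝ E] {f : M → E →L[ℝ] W'} {p : M} {m : WithTop ℕ∞}
    (h : ∀ v, ContMDiffAt 𝓘(ℝ, V) 𝓘(ℝ, W') m (fun q ↦ f q v) p) :
    ContMDiffAt 𝓘(ℝ, V) 𝓘(ℝ, E →L[ℝ] W') m f p := by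
  let b := Module.finBasis ℝ E
  let c : ∀ i, E →L[ℝ] ℝ := fun i ↦ LinearMap.toContinuousLinearMap (b.coord i)
  have hf : f = fun q ↦ ∑ i, ContinuousLinearMap.smulRightL ℝ E W' (c i) (f q (b i)) := by
    ext q v
    conv_lhs => rw [← b.sum_repr v, map_sum]
    simp [c]
  rw [hf]
  refine contMDiffAt_finsetSum fun i _ ↦ ?_
  exact (ContinuousLinearMap.contMDiff
    (ContinuousLinearMap.smulRightL ℝ E W' (c i))).contMDiffAt.comp p (h (b i))

lemma contMDiffCovariantDerivative [FiniteDimensional ℝ V] :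
    hΦ.connection.ContMDiffCovariantDerivative ∞ := by
  refine ⟨⟨fun {Y} hY p _ ↦ ?_⟩⟩
  have hY' : VField.SmoothAt Y p := (hY p trivial).contMDiffAt Filter.univ_mem
  refine ContMDiffAt.contMDiffWithinAt ?_
  rw [contMDiffAt_hom_bundle]
  refine ⟨contMDiffAt_id, contMDiffAt_clm_of_apply fun v ↦ ?_⟩
  let e := trivializationAt V (TangentSpace 𝓘(ℝ, V)) p
  have hp : p ∈ e.baseSet := FiberBundle.mem_baseSet_trivializationAt' p
  -- This field is constant in the trivialization at `p`; testing on such fields recovers the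
  -- coordinate expression of `∇Y`.
  let X : VField V M := fun q ↦ Bundle.Trivialization.symmL ℝ e q v
  have hX : X.SmoothAt p := by
    refine (e.contMDiffAt_section_iff hp).2 ?_
    refine (contMDiffAt_const (c := v)).congr_of_eventuallyEq ?_
    filter_upwards [e.open_baseSet.mem_nhds hp] with q hq
    simp only [X]
    rw [e.symmL_apply hq]
    exact congrArg Prod.snd (e.apply_mk_symm hq v)
  have h := (e.contMDiffAt_section_iff hp).1 (hΦ.connection_apply_smoothAt hX hY')
  refine h.congr_of_eventuallyEq ?_
  filter_upwards [e.open_baseSet.mem_nhds hp] with q hq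
  rw [ContinuousLinearMap.inCoordinates_eq hq hq]
  simp only [X, ContinuousLinearMap.comp_apply, ContinuousLinearEquiv.coe_coe,
    Bundle.Trivialization.symm_continuousLinearEquivAt_eq,
    Bundle.Trivialization.continuousLinearEquivAt_apply]
  rfl

/-- The coefficients of the form are constant in terms of Φ, so the product rule leaves only the
derivatives of dΦ(Y) and dΦ(Z). -/
lemma isParallelBilin (B : W →L[ℝ] W →L[ℝ] ℝ) {β : BilinField V M}
    (hβ : ∀ p v w, β p v w = B (dirDeriv Φ p v) (dirDeriv Φ p w)) :
    IsParallelBilin hΦ.connection β := by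
  intro p v Y Z hY hZ
  have hY' := (contMDiffAt_dirDeriv (hΦ.smooth p) hY).mdifferentiableAt (by simp)
  have hZ' := (contMDiffAt_dirDeriv (hΦ.smooth p) hZ).mdifferentiableAt (by simp)
  simp only [hβ, dirDeriv_connection]
  exact dirDeriv_bilin B hY' hZ' v

/-- Parallelism rewrites the three derivatives, and torsion-freeness the three brackets, in terms of
∇; everything then cancels by antisymmetry. -/
lemma isClosedTwoForm {β : BilinField V M} (hβ : IsParallelBilin hΦ.connection β)
    (hanti : ∀ p v w, β p v w = -β p w v) : IsClosedTwoForm β := by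
  intro p X Y Z hX hY hZ
  rw [hβ p _ Y Z hY hZ, hβ p _ X Z hX hZ, hβ p _ X Y hX hY, ← hΦ.connection_sub X Y hX hY,
    ← hΦ.connection_sub X Z hX hZ, ← hΦ.connection_sub Y Z hY hZ]
  simp only [map_sub, LinearMap.sub_apply]
  rw [hanti p (X p) (hΦ.connection Z p (Y p)), hanti p (Y p) (hΦ.connection Z p (X p)),
    hanti p (X p) (hΦ.connection Y p (Z p))]
  ring

lemma isParallelForm {m : ℕ} (Ω : W [⋀^Fin m]→ₗ[ℝ] ℝ) (hΩ : Continuous Ω) {ν : FormField V M m}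
    (hν : ∀ p v, ν p v = Ω (fun i ↦ dirDeriv Φ p (v i))) :
    IsParallelForm hΦ.connection ν := by
  intro p v Y hY
  let G : ContinuousMultilinearMap ℝ (fun _ : Fin m ↦ W) ℝ := ⟨Ω.toMultilinearMap, hΩ⟩
  have hYpi : MDifferentiableAt 𝓘(ℝ, V) 𝓘(ℝ, Fin m → W) (fun q i ↦ dirDeriv Φ q (Y i q)) p :=
    ((contMDiffAt_pi_space (n := 1)).2 fun i ↦
      (contMDiffAt_dirDeriv (hΦ.smooth p) (hY i)).of_le (by simp)).mdifferentiableAt (by simp)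
  have h1 := dirDeriv_comp_differentiableAt (G := G) (G.hasFDerivAt _).differentiableAt hYpi v
  rw [(G.hasFDerivAt _).fderiv, ContinuousMultilinearMap.linearDeriv_apply] at h1
  simp only [hν]
  refine h1.trans (Finset.sum_congr rfl fun i _ ↦ ?_)
  rw [dirDeriv_apply hYpi, ← hΦ.dirDeriv_connection]
  refine congrArg Ω (funext fun j ↦ ?_)
  rcases eq_or_ne j i with rfl | hj
  · simp
  · simp [hj]

lemma eq_connection_of_dirDeriv_eq {D : Connection V M} {Y : VField V M} {p : M}
    (h : ∀ v, dirDeriv Φ p (D Y p v) = dirDeriv (fun q ↦ dirDeriv Φ q (Y q)) p v) :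
    D Y p = hΦ.connection Y p := by
  ext v
  exact hΦ.dirDeriv_injective p ((h v).trans (hΦ.dirDeriv_connection Y p v).symm)

/-- A function with parallel differential which vanishes at one point is constant. -/
lemma eq_of_hessian_eq_zero [ConnectedSpace M] {h : M → W'}
    (hh : ContMDiff 𝓘(ℝ, V) 𝓘(ℝ, W') ∞ h)
    (hess : ∀ (p : M) (v : TangentSpace 𝓘(ℝ, V) p) (Y : VField V M), Y.SmoothAt p →
      dirDeriv (fun q ↦ dirDeriv h q (Y q)) p v = dirDeriv h p (hΦ.connection Y p v))
    {p₀ : M} (h₀ : ∀ v : TangentSpace 𝓘(ℝ, V) p₀, dirDeriv h p₀ v = 0) (p q : M) :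
    h p = h q := by
  refine eq_of_dirDeriv_eq_zero (hh.mdifferentiable (by simp)) (fun p v ↦ ?_) p q
  -- Frame fields are parallel, so `dh` of a frame field has zero derivative and equals its value at
  -- `p₀`, which is zero.
  have hframe : ∀ w q, hΦ.connection (frameField V Φ w) q = 0 := by
    intro w q
    ext v
    apply hΦ.dirDeriv_injective q
    rw [dirDeriv_connection]
    simp only [hΦ.dirDeriv_frameField, dirDeriv_const]
    exact (dirDeriv_map_zero Φ q).symm
  have hconst := eq_of_dirDeriv_eq_zero
    (f := fun q ↦ dirDeriv h q (frameField V Φ (dirDeriv Φ p v) q))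
    (fun q ↦ (contMDiffAt_dirDeriv (hh q) (hΦ.smoothAt_frameField _ q)).mdifferentiableAt (by simp))
    (fun q u ↦ by
      rw [hess q u _ (hΦ.smoothAt_frameField _ q), hframe]
      exact dirDeriv_map_zero h q) p p₀
  rwa [hΦ.frameField_dirDeriv, h₀] at hconst

end IsDevelopingMap

end Developing

/-! ### Holomorphic maps as smooth real maps. -/

section RestrictScalars

variable {E : Type*} [NormedAddCommGroup E] [NormedSpace ℂ E] [NormedSpace ℝ E]
  [IsScalarTower ℝ ℂ E]
  {M : Type*} [TopologicalSpace M] [ChartedSpace E M]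
  {W : Type*} [NormedAddCommGroup W] [NormedSpace ℂ W] [NormedSpace ℝ W] [IsScalarTower ℝ ℂ W]

lemma MDifferentiableAt.restrictScalars_real {f : M → W} {p : M}
    (hf : MDifferentiableAt 𝓘(ℂ, E) 𝓘(ℂ, W) f p) : MDifferentiableAt 𝓘(ℝ, E) 𝓘(ℝ, W) f p := by
  rw [mdifferentiableAt_iff] at hf ⊢
  exact ⟨hf.1, hf.2.restrictScalars ℝ⟩

lemma MDifferentiableAt.dirDeriv_eq {f : M → W} {p : M}
    (hf : MDifferentiableAt 𝓘(ℂ, E) 𝓘(ℂ, W) f p) (v : E) :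
    dirDeriv f p v = mvfderiv 𝓘(ℂ, E) f p v := by
  have h1 := hf.mvfderiv
  have h2 := hf.restrictScalars_real.mvfderiv
  have h3 := ((mdifferentiableAt_iff _ _).1 hf).2
  simp only [modelWithCornersSelf_coe, Set.range_id, fderivWithin_univ,
    differentiableWithinAt_univ] at h1 h2 h3
  have h4 := h3.fderiv_restrictScalars ℝ
  change mvfderiv 𝓘(ℝ, E) f p v = _
  rw [h2, h1]
  exact DFunLike.congr_fun h4 v

lemma ContMDiffAt.restrictScalars_real {f : M → W} {p : M} {m : WithTop ℕ∞}
    (hf : ContMDiffAt 𝓘(ℂ, E) 𝓘(ℂ, W) m f p) : ContMDiffAt 𝓘(ℝ, E) 𝓘(ℝ, W) m f p := by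
  rw [contMDiffAt_iff] at hf ⊢
  exact ⟨hf.1, hf.2.restrict_scalars ℝ⟩

end RestrictScalars

/-! ### Partial derivatives with respect to the coordinates z̃. -/

section PartialDeriv

variable {n : ℕ} {M : Type*} [TopologicalSpace M] [ChartedSpace (Fin n → ℂ) M]
  {π : M → Fin n → ℂ} {h : M → ℂ}

lemma mvfderiv_eq_sum_partialDeriv {p : M}
    (hπ : (mvfderiv 𝓘(ℂ, Fin n → ℂ) π p).IsInvertible) (v : Fin n → ℂ) :
    mvfderiv 𝓘(ℂ, Fin n → ℂ) h p v
      = ∑ j, partialDeriv π h j p * mvfderiv 𝓘(ℂ, Fin n → ℂ) π p v j := by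
  obtain ⟨A, hA⟩ := hπ
  have hv : (v : TangentSpace 𝓘(ℂ, Fin n → ℂ) p) = A.symm (A v) := (A.symm_apply_apply v).symm
  simp only [partialDeriv, ← hA, ContinuousLinearMap.inverse_equiv]
  have h1 : A v = ∑ j, A v j • Pi.single j (1 : ℂ) := (pi_eq_sum_univ' _).trans (by simp)
  conv_lhs => rw [hv, h1]
  simp [map_sum, map_smul, mul_comm]

lemma isInvertible_mvfderiv_of_isLocalDiffeomorph
    (hπ : IsLocalDiffeomorph 𝓘(ℂ, Fin n → ℂ) 𝓘(ℂ, Fin n → ℂ) ω π) (p : M) :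
    (mvfderiv 𝓘(ℂ, Fin n → ℂ) π p).IsInvertible :=
  ⟨(hπ p).mfderivToContinuousLinearEquiv (by simp), rfl⟩

/-- Near `p` the map `π` has a holomorphic inverse s, and h = (h ∘ s) ∘ π. This replaces the
pointwise inverse of dπ by an ordinary partial derivative of h ∘ s, from which holomorphy is
visible. -/
lemma partialDeriv_eventuallyEq
    (hπ : IsLocalDiffeomorph 𝓘(ℂ, Fin n → ℂ) 𝓘(ℂ, Fin n → ℂ) ω π)
    (hh : ContMDiff 𝓘(ℂ, Fin n → ℂ) 𝓘(ℂ, ℂ) ω h) (j : Fin n) (p : M) :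
    partialDeriv π h j =ᶠ[𝓝 p]
      fun q ↦ fderiv ℂ (h ∘ (hπ p).localInverse) (π q) (Pi.single j 1) := by
  filter_upwards [(hπ p).localInverse.open_target.mem_nhds (hπ p).localInverse_mem_target]
    with q hq
  have hq' : π q ∈ (hπ p).localInverse.source := by
    have h1 := (hπ p).localInverse.map_target hq
    have h2 : (hπ p).localInverse.toPartialEquiv.symm q = π q := by
      have h3 := (hπ p).localInverse_right_inv h1
      rw [← h3]
      exact congrArg π ((hπ p).localInverse.right_inv hq)
    rwa [h2] at h1
  have hσ : MDifferentiableAt 𝓘(ℂ, Fin n → ℂ) 𝓘(ℂ, Fin n → ℂ) (hπ p).localInverse (π q) :=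
    (hπ p).localInverse.mdifferentiableAt (by simp) hq'
  have heq : h =ᶠ[𝓝 q] (h ∘ (hπ p).localInverse) ∘ π := by
    filter_upwards [(hπ p).localInverse.open_target.mem_nhds hq] with x hx
    simp only [Function.comp_apply, (hπ p).localInverse_left_inv hx]
  have hhσ := ((hh _).mdifferentiableAt (by simp)).comp (π q) hσ
  have hd : mfderiv 𝓘(ℂ, Fin n → ℂ) 𝓘(ℂ, ℂ) h q
      = (mfderiv 𝓘(ℂ, Fin n → ℂ) 𝓘(ℂ, ℂ) (h ∘ (hπ p).localInverse) (π q)).comp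
        (mfderiv 𝓘(ℂ, Fin n → ℂ) 𝓘(ℂ, Fin n → ℂ) π q) := by
    rw [heq.mfderiv_eq, mfderiv_comp q hhσ ((hπ q).mdifferentiableAt (by simp))]
  obtain ⟨A, hA⟩ := isInvertible_mvfderiv_of_isLocalDiffeomorph hπ q
  rw [← mfderiv_eq_fderiv]
  refine (DFunLike.congr_fun hd _).trans ?_
  rw [← hA, ContinuousLinearMap.inverse_equiv]
  refine congrArg (mfderiv 𝓘(ℂ, Fin n → ℂ) 𝓘(ℂ, ℂ) (h ∘ (hπ p).localInverse) (π q)) ?_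
  refine Eq.trans ?_ (A.apply_symm_apply (Pi.single j 1))
  exact (DFunLike.congr_fun hA (A.symm (Pi.single j 1))).symm

lemma contMDiff_partialDeriv
    (hπ : IsLocalDiffeomorph 𝓘(ℂ, Fin n → ℂ) 𝓘(ℂ, Fin n → ℂ) ω π)
    (hh : ContMDiff 𝓘(ℂ, Fin n → ℂ) 𝓘(ℂ, ℂ) ω h) (j : Fin n) :
    ContMDiff 𝓘(ℂ, Fin n → ℂ) 𝓘(ℂ, ℂ) ω (partialDeriv π h j) := by
  intro p
  refine ContMDiffAt.congr_of_eventuallyEq ?_ (partialDeriv_eventuallyEq hπ hh j p)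
  have h1 : ContDiffAt ℂ ω (h ∘ (hπ p).localInverse) (π p) :=
    ((hh _).comp (π p) (hπ p).localInverse_contMDiffAt).contDiffAt
  have h2 := (h1.fderiv_right (m := ω) le_rfl).clm_apply (contDiffAt_const (c := Pi.single j 1))
  exact h2.contMDiffAt.comp p (hπ p).contMDiffAt

end PartialDeriv

/-! ### The affine coordinates Φ, their conjugates Ψ, and invertibility of dΦ. -/

section SpecialKaehler

variable {n : ℕ} {M : Type*} [TopologicalSpace M] [ChartedSpace (Fin n → ℂ) M]
  [IsManifold 𝓘(ℂ, Fin n → ℂ) ω M] {π : M → Fin n → ℂ} {F : M → ℂ}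

/-- The map `(x̃, ỹ)` whose components are the affine coordinates. -/
def affineCoords (π : M → Fin n → ℂ) (F : M → ℂ) (p : M) : Fin (n + n) → ℝ :=
  Fin.append (fun i ↦ xCoord π i p) (fun j ↦ yCoord π F j p)

/-- The map `(-Im z̃, -Im w̃)`. -/
def conjCoords (π : M → Fin n → ℂ) (F : M → ℂ) (p : M) : Fin (n + n) → ℝ :=
  Fin.append (fun i ↦ -(π p i).im) (fun j ↦ -(partialDeriv π F j p).im)

/-- The bilinear form `∑ (aᵢ b'ᵢ - bᵢ a'ᵢ)` on `ℝ^{2n}`. -/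
def stdSymplectic (n : ℕ) : (Fin (n + n) → ℝ) →L[ℝ] (Fin (n + n) → ℝ) →L[ℝ] ℝ :=
  ∑ i : Fin n,
    ((ContinuousLinearMap.proj (R := ℝ) (φ := fun _ ↦ ℝ) (Fin.castAdd n i)).smulRight
        (ContinuousLinearMap.proj (R := ℝ) (φ := fun _ ↦ ℝ) (Fin.natAdd n i))
      - (ContinuousLinearMap.proj (R := ℝ) (φ := fun _ ↦ ℝ) (Fin.natAdd n i)).smulRight
        (ContinuousLinearMap.proj (R := ℝ) (φ := fun _ ↦ ℝ) (Fin.castAdd n i)))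

lemma stdSymplectic_apply (a b : Fin (n + n) → ℝ) :
    stdSymplectic n a b = ∑ i : Fin n,
      (a (Fin.castAdd n i) * b (Fin.natAdd n i) - b (Fin.castAdd n i) * a (Fin.natAdd n i)) := by
  simp [stdSymplectic, mul_comm]

lemma stdSymplectic_swap (a b : Fin (n + n) → ℝ) :
    stdSymplectic n a b = -stdSymplectic n b a := by
  simp [stdSymplectic_apply]

/-- Each coordinate is detected, up to sign, by pairing with the basis vector of the conjugate
coordinate. -/
lemma eq_zero_of_stdSymplectic_eq_zero {a : Fin (n + n) → ℝ} (h : ∀ b, stdSymplectic n a b = 0) :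
    a = 0 := by
  ext k
  refine Fin.addCases (fun i ↦ ?_) (fun i ↦ ?_) k
  · have h1 := h (Pi.single (Fin.natAdd n i) 1)
    rw [stdSymplectic_apply, Finset.sum_eq_single i] at h1
    · simpa [Pi.single_apply, Fin.ext_iff, i.pos.ne', -Fin.natAdd_eq_addNat] using h1
    · intro j _ hj
      have hj' : (j : ℕ) ≠ i := fun h ↦ hj (Fin.ext h)
      have hj'' : (j : ℕ) ≠ n + i := by omega
      simp [Fin.ext_iff, hj', hj'', -Fin.natAdd_eq_addNat]
    · simp
  · have h1 := h (Pi.single (Fin.castAdd n i) 1)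
    rw [stdSymplectic_apply, Finset.sum_eq_single i] at h1
    · simpa [Pi.single_apply, Fin.ext_iff, i.pos.ne', -Fin.natAdd_eq_addNat] using h1
    · intro j _ hj
      have hj' : (j : ℕ) ≠ i := fun h ↦ hj (Fin.ext h)
      have hj'' : n + (j : ℕ) ≠ i := by omega
      simp [Fin.ext_iff, hj', hj'', -Fin.natAdd_eq_addNat]
    · simp

variable (hπ : IsLocalDiffeomorph 𝓘(ℂ, Fin n → ℂ) 𝓘(ℂ, Fin n → ℂ) ω π)
  (hF : ContMDiff 𝓘(ℂ, Fin n → ℂ) 𝓘(ℂ, ℂ) ω F)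

lemma contMDiff_real_of_complex {W : Type*} [NormedAddCommGroup W] [NormedSpace ℂ W]
    {f : M → W} (hf : ContMDiff 𝓘(ℂ, Fin n → ℂ) 𝓘(ℂ, W) ω f) :
    ContMDiff 𝓘(ℝ, Fin n → ℂ) 𝓘(ℝ, W) ∞ f :=
  fun p ↦ (hf p).restrictScalars_real.of_le le_top

lemma dirDeriv_complexStructure {W : Type*} [NormedAddCommGroup W] [NormedSpace ℂ W]
    {f : M → W} {p : M} (hf : MDifferentiableAt 𝓘(ℂ, Fin n → ℂ) 𝓘(ℂ, W) f p)
    (v : TangentSpace 𝓘(ℝ, Fin n → ℂ) p) :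
    dirDeriv f p (complexStructure p v) = Complex.I • dirDeriv f p v := by
  have h1 := hf.dirDeriv_eq (complexStructure p v)
  have h2 := hf.dirDeriv_eq v
  refine h1.trans ?_
  refine Eq.trans ?_ (congrArg (Complex.I • ·) h2).symm
  exact map_smul (mvfderiv 𝓘(ℂ, Fin n → ℂ) f p) Complex.I
    (show TangentSpace 𝓘(ℂ, Fin n → ℂ) p from v)

include hπ in
lemma dirDeriv_eq_sum_partialDeriv {h : M → ℂ}
    (hh : ContMDiff 𝓘(ℂ, Fin n → ℂ) 𝓘(ℂ, ℂ) ω h) (p : M)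
    (v : TangentSpace 𝓘(ℝ, Fin n → ℂ) p) :
    dirDeriv h p v = ∑ j, partialDeriv π h j p * dirDeriv π p v j := by
  refine (((hh p).mdifferentiableAt (by simp)).dirDeriv_eq v).trans ?_
  rw [mvfderiv_eq_sum_partialDeriv (isInvertible_mvfderiv_of_isLocalDiffeomorph hπ p) v]
  refine Finset.sum_congr rfl fun j _ ↦ congrArg _ ?_
  exact congrFun (((hπ p).mdifferentiableAt (by simp)).dirDeriv_eq v).symm j

lemma dirDeriv_re {h : M → ℂ} {p : M}
    (hh : MDifferentiableAt 𝓘(ℝ, Fin n → ℂ) 𝓘(ℝ, ℂ) h p) (v : TangentSpace 𝓘(ℝ, Fin n → ℂ) p) :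
    dirDeriv (fun q ↦ (h q).re) p v = (dirDeriv h p v).re :=
  dirDeriv_clm_comp Complex.reCLM hh v

lemma dirDeriv_im {h : M → ℂ} {p : M}
    (hh : MDifferentiableAt 𝓘(ℝ, Fin n → ℂ) 𝓘(ℝ, ℂ) h p) (v : TangentSpace 𝓘(ℝ, Fin n → ℂ) p) :
    dirDeriv (fun q ↦ (h q).im) p v = (dirDeriv h p v).im :=
  dirDeriv_clm_comp Complex.imCLM hh v

include hπ in
lemma contMDiff_real_proj : ContMDiff 𝓘(ℝ, Fin n → ℂ) 𝓘(ℝ, Fin n → ℂ) ∞ π :=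
  contMDiff_real_of_complex hπ.contMDiff

include hπ in
lemma contMDiff_real_component (i : Fin n) :
    ContMDiff 𝓘(ℝ, Fin n → ℂ) 𝓘(ℝ, ℂ) ∞ (fun q ↦ π q i) :=
  contMDiff_pi_space.1 (contMDiff_real_proj hπ) i

include hπ hF in
lemma contMDiff_real_partialDeriv (j : Fin n) :
    ContMDiff 𝓘(ℝ, Fin n → ℂ) 𝓘(ℝ, ℂ) ∞ (partialDeriv π F j) :=
  contMDiff_real_of_complex (contMDiff_partialDeriv hπ hF j)

include hπ in
lemma dirDeriv_xCoord (i : Fin n) (p : M) (v : TangentSpace 𝓘(ℝ, Fin n → ℂ) p) :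
    dirDeriv (xCoord π i) p v = (dirDeriv π p v i).re := by
  rw [dirDeriv_apply ((contMDiff_real_proj hπ p).mdifferentiableAt (by simp))]
  exact dirDeriv_re ((contMDiff_real_component hπ i p).mdifferentiableAt (by simp)) v

include hπ hF in
lemma dirDeriv_yCoord (j : Fin n) (p : M) (v : TangentSpace 𝓘(ℝ, Fin n → ℂ) p) :
    dirDeriv (yCoord π F j) p v = (dirDeriv (partialDeriv π F j) p v).re :=
  dirDeriv_re ((contMDiff_real_partialDeriv hπ hF j p).mdifferentiableAt (by simp)) v

include hπ in
lemma contMDiff_xCoord (i : Fin n) : ContMDiff 𝓘(ℝ, Fin n → ℂ) 𝓘(ℝ, ℝ) ∞ (xCoord π i) :=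
  Complex.reCLM.contMDiff.comp (contMDiff_real_component hπ i)

include hπ hF in
lemma contMDiff_yCoord (j : Fin n) : ContMDiff 𝓘(ℝ, Fin n → ℂ) 𝓘(ℝ, ℝ) ∞ (yCoord π F j) :=
  Complex.reCLM.contMDiff.comp (contMDiff_real_partialDeriv hπ hF j)

lemma contMDiff_append {f g : Fin n → M → ℝ}
    (hf : ∀ i, ContMDiff 𝓘(ℝ, Fin n → ℂ) 𝓘(ℝ, ℝ) ∞ (f i))
    (hg : ∀ i, ContMDiff 𝓘(ℝ, Fin n → ℂ) 𝓘(ℝ, ℝ) ∞ (g i)) :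
    ContMDiff 𝓘(ℝ, Fin n → ℂ) 𝓘(ℝ, Fin (n + n) → ℝ) ∞
      (fun p ↦ Fin.append (fun i ↦ f i p) (fun j ↦ g j p)) := by
  refine contMDiff_pi_space.2 fun k ↦ ?_
  refine Fin.addCases (fun i ↦ ?_) (fun j ↦ ?_) k
  · simpa only [Fin.append_left] using hf i
  · simpa only [Fin.append_right] using hg j

lemma dirDeriv_append {f g : Fin n → M → ℝ}
    (hf : ∀ i, ContMDiff 𝓘(ℝ, Fin n → ℂ) 𝓘(ℝ, ℝ) ∞ (f i))
    (hg : ∀ i, ContMDiff 𝓘(ℝ, Fin n → ℂ) 𝓘(ℝ, ℝ) ∞ (g i)) (p : M)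
    (v : TangentSpace 𝓘(ℝ, Fin n → ℂ) p) :
    dirDeriv (fun p ↦ Fin.append (fun i ↦ f i p) (fun j ↦ g j p)) p v
      = Fin.append (fun i ↦ dirDeriv (f i) p v) (fun j ↦ dirDeriv (g j) p v) := by
  have h := (contMDiff_append hf hg p).mdifferentiableAt (by simp)
  ext k
  rw [dirDeriv_apply h]
  refine Fin.addCases (fun i ↦ ?_) (fun j ↦ ?_) k
  · simp only [Fin.append_left]
  · simp only [Fin.append_right]

include hπ hF in
lemma dirDeriv_affineCoords (p : M) (v : TangentSpace 𝓘(ℝ, Fin n → ℂ) p) :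
    dirDeriv (affineCoords π F) p v
      = Fin.append (fun i ↦ (dirDeriv π p v i).re)
        (fun j ↦ (dirDeriv (partialDeriv π F j) p v).re) := by
  refine (dirDeriv_append (contMDiff_xCoord hπ) (contMDiff_yCoord hπ hF) p v).trans ?_
  simp only [dirDeriv_xCoord hπ, dirDeriv_yCoord hπ hF]

include hπ hF in
lemma contMDiff_conjCoords :
    ContMDiff 𝓘(ℝ, Fin n → ℂ) 𝓘(ℝ, Fin (n + n) → ℝ) ∞ (conjCoords π F) :=
  contMDiff_append (fun i ↦ (-Complex.imCLM).contMDiff.comp (contMDiff_real_component hπ i))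
    (fun j ↦ (-Complex.imCLM).contMDiff.comp (contMDiff_real_partialDeriv hπ hF j))

-- Re(iζ) = -Im ζ. Thus dΦ ∘ J is again the differential of a map, which turns statements about J
-- into statements about Ψ.
include hπ hF in
lemma dirDeriv_conjCoords (p : M) (v : TangentSpace 𝓘(ℝ, Fin n → ℂ) p) :
    dirDeriv (affineCoords π F) p (complexStructure p v) = dirDeriv (conjCoords π F) p v := by
  have h1 := dirDeriv_append
    (fun i ↦ (-Complex.imCLM).contMDiff.comp (contMDiff_real_component hπ i))
    (fun j ↦ (-Complex.imCLM).contMDiff.comp (contMDiff_real_partialDeriv hπ hF j)) p v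
  refine Eq.trans ?_ h1.symm
  rw [dirDeriv_affineCoords hπ hF, dirDeriv_complexStructure ((hπ p).mdifferentiableAt (by simp))]
  congr 1
  · ext i
    refine Eq.trans ?_ (dirDeriv_clm_comp (-Complex.imCLM)
      ((contMDiff_real_component hπ i p).mdifferentiableAt (by simp)) v).symm
    rw [← dirDeriv_apply ((contMDiff_real_proj hπ p).mdifferentiableAt (by simp))]
    simp
  · ext j
    refine Eq.trans ?_ (dirDeriv_clm_comp (-Complex.imCLM)
      ((contMDiff_real_partialDeriv hπ hF j p).mdifferentiableAt (by simp)) v).symm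
    rw [dirDeriv_complexStructure ((contMDiff_partialDeriv hπ hF j p).mdifferentiableAt (by simp))]
    simp

include hπ hF in
lemma isDevelopingMap_affineCoords (hnd : IsNondegenerate π F) :
    IsDevelopingMap (Fin n → ℂ) (affineCoords π F) where
  smooth := contMDiff_append (contMDiff_xCoord hπ) (contMDiff_yCoord hπ hF)
  invertible p := by
    let L : (Fin n → ℂ) →L[ℝ] (Fin (n + n) → ℝ) := mvfderiv 𝓘(ℝ, Fin n → ℂ) (affineCoords π F) p
    have hker : ∀ v : TangentSpace 𝓘(ℝ, Fin n → ℂ) p,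
        dirDeriv (affineCoords π F) p v = 0 → v = 0 := by
      intro v hv
      rw [dirDeriv_affineCoords hπ hF] at hv
      have hx : ∀ i, (dirDeriv π p v i).re = 0 := fun i ↦ by
        simpa using congrFun hv (Fin.castAdd n i)
      have hy : ∀ j, (dirDeriv (partialDeriv π F j) p v).re = 0 := fun j ↦ by
        simpa only [Fin.append_right, Pi.zero_apply] using congrFun hv (Fin.natAdd n j)
      -- Here dz̃(v) = it with t real, so Re dw̃ⱼ(v) = -∑ tᵢ Im(∂²F/∂z̃ⁱ∂z̃ʲ); nondegeneracy of `F`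
      -- forces t = 0.
      have him : (fun i ↦ (dirDeriv π p v i).im) = 0 := by
        have hinj := Matrix.vecMul_injective_of_isUnit (hnd p)
        refine hinj ?_
        ext j
        simp only [Matrix.zero_vecMul]
        have := hy j
        rw [dirDeriv_eq_sum_partialDeriv hπ (contMDiff_partialDeriv hπ hF j)] at this
        simp only [Complex.re_sum, Complex.mul_re, hx, mul_zero, zero_sub, Finset.sum_neg_distrib,
          neg_eq_zero] at this
        simpa [Matrix.vecMul, dotProduct, mul_comm] using this
      have hz : dirDeriv π p v = 0 := by
        ext i
        exact Complex.ext (hx i) (congrFun him i)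
      obtain ⟨A, hA⟩ := isInvertible_mvfderiv_of_isLocalDiffeomorph hπ p
      have hz' := (((hπ p).mdifferentiableAt (by simp)).dirDeriv_eq v).symm.trans hz
      rw [← hA] at hz'
      exact A.injective (hz'.trans (map_zero A).symm)
    have hinj : Function.Injective L := (injective_iff_map_eq_zero L).2 hker
    -- Both spaces have real dimension 2n, so injectivity suffices.
    have hrank : Module.finrank ℝ (Fin n → ℂ) = Module.finrank ℝ (Fin (n + n) → ℝ) := by
      simp [Module.finrank_pi_fintype, mul_two]
    exact ⟨(LinearEquiv.ofInjectiveOfFinrankEq (L : (Fin n → ℂ) →ₗ[ℝ] _) hinj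
      hrank).toContinuousLinearEquiv, by ext v; rfl⟩

end SpecialKaehler

/-! ### The metric g in terms of σ, and the special Kähler structure. -/

section SpecialKaehler

variable {n : ℕ} {M : Type*} [TopologicalSpace M] [ChartedSpace (Fin n → ℂ) M]
  [IsManifold 𝓘(ℂ, Fin n → ℂ) ω M] {π : M → Fin n → ℂ} {F : M → ℂ}

variable (hπ : IsLocalDiffeomorph 𝓘(ℂ, Fin n → ℂ) 𝓘(ℂ, Fin n → ℂ) ω π)
  (hF : ContMDiff 𝓘(ℂ, Fin n → ℂ) 𝓘(ℂ, ℂ) ω F) (hnd : IsNondegenerate π F)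

include hπ in
lemma dirDeriv_eq_sum_component {h : M → ℂ}
    (hh : ContMDiff 𝓘(ℂ, Fin n → ℂ) 𝓘(ℂ, ℂ) ω h) (p : M)
    (v : TangentSpace 𝓘(ℝ, Fin n → ℂ) p) :
    dirDeriv h p v = ∑ j, partialDeriv π h j p * dirDeriv (fun q ↦ π q j) p v := by
  rw [dirDeriv_eq_sum_partialDeriv hπ hh]
  exact Finset.sum_congr rfl fun j _ ↦ congrArg _
    (dirDeriv_apply ((contMDiff_real_proj hπ p).mdifferentiableAt (by simp)) v j)

include hπ hF in
lemma dirDeriv_dirDeriv_holomorphic {p : M} {Y : VField (Fin n → ℂ) M} (hY : Y.SmoothAt p)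
    (v : TangentSpace 𝓘(ℝ, Fin n → ℂ) p) :
    dirDeriv (fun q ↦ dirDeriv F q (Y q)) p v
      = ∑ j, (partialDeriv π F j p * dirDeriv (fun q ↦ dirDeriv (fun x ↦ π x j) q (Y q)) p v
        + dirDeriv (partialDeriv π F j) p v * dirDeriv (fun q ↦ π q j) p (Y p)) := by
  have hw := fun j ↦ (contMDiff_real_partialDeriv hπ hF j p).mdifferentiableAt (by simp)
  have hz := fun j ↦ (contMDiffAt_dirDeriv (contMDiff_real_component hπ j p) hY).mdifferentiableAt
    (by simp)
  simp only [dirDeriv_eq_sum_component hπ hF]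
  rw [dirDeriv_fun_sum fun j _ ↦ mdifferentiableAt_fun_mul (hw j) (hz j)]
  exact Finset.sum_congr rfl fun j _ ↦ dirDeriv_fun_mul (hw j) (hz j) v

include hπ hF hnd in
/-- The map `(z̃, w̃)` is Lagrangian. -/
lemma sum_dirDeriv_lagrangian (p : M) (v u : TangentSpace 𝓘(ℝ, Fin n → ℂ) p) :
    ∑ i, (dirDeriv π p v i * dirDeriv (partialDeriv π F i) p u
      - dirDeriv π p u i * dirDeriv (partialDeriv π F i) p v) = 0 := by
  have hΦ := isDevelopingMap_affineCoords hπ hF hnd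
  -- The developing map serves to extend the two tangent vectors to smooth fields.
  obtain ⟨X, hX, hXp⟩ : ∃ X : VField (Fin n → ℂ) M, X.SmoothAt p ∧ X p = v :=
    ⟨_, hΦ.smoothAt_frameField _ p, hΦ.frameField_dirDeriv p v⟩
  obtain ⟨Y, hY, hYp⟩ : ∃ Y : VField (Fin n → ℂ) M, Y.SmoothAt p ∧ Y p = u :=
    ⟨_, hΦ.smoothAt_frameField _ p, hΦ.frameField_dirDeriv p u⟩
  -- With dF = ∑ w̃ⱼ dz̃ʲ this is d(dF) = 0. Subtracting w̃ⱼ times the commutator identity for each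
  -- z̃ʲ leaves ∑ dw̃ⱼ ∧ dz̃ʲ = 0.
  have h := dirDeriv_dirDeriv_sub (contMDiff_real_of_complex hF p) hX hY
  have hz := fun j ↦ dirDeriv_dirDeriv_sub (contMDiff_real_component hπ j p) hX hY
  rw [dirDeriv_dirDeriv_holomorphic hπ hF hX, dirDeriv_dirDeriv_holomorphic hπ hF hY,
    dirDeriv_eq_sum_component hπ hF, ← sub_eq_zero, ← Finset.sum_sub_distrib,
    ← Finset.sum_sub_distrib] at h
  rw [hXp, hYp] at h
  rw [← neg_eq_zero, ← h, ← Finset.sum_neg_distrib]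
  refine Finset.sum_congr rfl fun j _ ↦ ?_
  have hzj := hz j
  rw [hXp, hYp] at hzj
  rw [← hzj, dirDeriv_apply ((contMDiff_real_proj hπ p).mdifferentiableAt (by simp)),
    dirDeriv_apply ((contMDiff_real_proj hπ p).mdifferentiableAt (by simp))]
  ring

include hπ hF in
lemma contMDiff_lagrangianMap : ContMDiff 𝓘(ℂ, Fin n → ℂ) 𝓘(ℂ, (Fin n → ℂ) × (Fin n → ℂ)) ω
    (lagrangianMap π F) :=
  hπ.contMDiff.prodMk_space (contMDiff_pi_space.2 fun j ↦ contMDiff_partialDeriv hπ hF j)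

include hπ hF in
lemma dirDeriv_lagrangianMap (p : M) (v : TangentSpace 𝓘(ℝ, Fin n → ℂ) p) :
    dirDeriv (lagrangianMap π F) p v
      = (dirDeriv π p v, fun j ↦ dirDeriv (partialDeriv π F j) p v) := by
  have h := ((contMDiff_real_of_complex (contMDiff_lagrangianMap hπ hF)) p).mdifferentiableAt
    (by simp)
  refine Prod.ext (dirDeriv_clm_comp (ContinuousLinearMap.fst ℝ _ _) h v).symm (funext fun j ↦ ?_)
  exact (dirDeriv_clm_comp ((ContinuousLinearMap.proj (R := ℝ) (φ := fun _ ↦ ℂ) j).comp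
    (ContinuousLinearMap.snd ℝ (Fin n → ℂ) (Fin n → ℂ))) h v).symm

lemma specialMetric_apply (p : M) (v u : TangentSpace 𝓘(ℝ, Fin n → ℂ) p) :
    specialMetric π F p v u = (hermitianForm (dirDeriv (lagrangianMap π F) p v)
      (dirDeriv (lagrangianMap π F) p u)).re := rfl

include hπ hF in
lemma dirDeriv_lagrangianMap_complexStructure (p : M) (v : TangentSpace 𝓘(ℝ, Fin n → ℂ) p) :
    dirDeriv (lagrangianMap π F) p (complexStructure p v)
      = Complex.I • dirDeriv (lagrangianMap π F) p v :=
  dirDeriv_complexStructure ((contMDiff_lagrangianMap hπ hF p).mdifferentiableAt (by simp)) v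

lemma complexStructure_complexStructure (p : M) (v : TangentSpace 𝓘(ℝ, Fin n → ℂ) p) :
    complexStructure p (complexStructure p v) = -v := by
  change Complex.I • (Complex.I • (show Fin n → ℂ from v)) = -(show Fin n → ℂ from v)
  rw [smul_smul, Complex.I_mul_I, neg_one_smul]

include hπ hF in
lemma specialMetric_hermitian (p : M) (v u : TangentSpace 𝓘(ℝ, Fin n → ℂ) p) :
    specialMetric π F p (complexStructure p v) (complexStructure p u)
      = specialMetric π F p v u := by
  rw [specialMetric_apply, specialMetric_apply, dirDeriv_lagrangianMap_complexStructure hπ hF,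
    dirDeriv_lagrangianMap_complexStructure hπ hF]
  congr 1
  simp only [hermitianForm, symplecticForm]
  congr 1
  refine Finset.sum_congr rfl fun i _ ↦ ?_
  simp
  ring_nf
  simp
  ring

/-- The left side is Re Ω(A, C̄) with A = (a, b), C = (c, d), because i times the conjugate of i is
1. Adding the real part of Ω(A, C) = 0 cancels the products of imaginary parts and doubles those of
real parts. -/
lemma re_hermitianForm_I_smul {a b c d : Fin n → ℂ} (h : ∑ i, (a i * d i - c i * b i) = 0) :
    (hermitianForm (a, b) (Complex.I • (c, d))).re
      = 2 * ∑ i, ((a i).re * (d i).re - (c i).re * (b i).re) := by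
  have h' := congrArg Complex.re h
  rw [Complex.re_sum, Complex.zero_re] at h'
  rw [Finset.mul_sum, ← sub_eq_zero, ← neg_eq_zero, ← h', hermitianForm, symplecticForm,
    Finset.mul_sum, Complex.re_sum, ← Finset.sum_sub_distrib, ← Finset.sum_neg_distrib]
  refine Finset.sum_congr rfl fun i _ ↦ ?_
  simp
  ring

-- The key identity: the Kähler form has constant coefficients in the coordinates Φ.
include hπ hF hnd in
lemma specialMetric_complexStructure (p : M) (v u : TangentSpace 𝓘(ℝ, Fin n → ℂ) p) :
    specialMetric π F p v (complexStructure p u)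
      = 2 * stdSymplectic n (dirDeriv (affineCoords π F) p v)
        (dirDeriv (affineCoords π F) p u) := by
  rw [specialMetric_apply, dirDeriv_lagrangianMap_complexStructure hπ hF,
    dirDeriv_lagrangianMap hπ hF, dirDeriv_lagrangianMap hπ hF,
    re_hermitianForm_I_smul (sum_dirDeriv_lagrangian hπ hF hnd p v u), stdSymplectic_apply,
    dirDeriv_affineCoords hπ hF, dirDeriv_affineCoords hπ hF]
  simp only [Fin.append_left, Fin.append_right]

-- This form expresses g through differentials of smooth maps, which gives its smoothness.
include hπ hF hnd in
lemma specialMetric_eq (p : M) (v u : TangentSpace 𝓘(ℝ, Fin n → ℂ) p) :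
    specialMetric π F p v u
      = -2 * stdSymplectic n (dirDeriv (affineCoords π F) p v)
        (dirDeriv (conjCoords π F) p u) := by
  have h := specialMetric_complexStructure hπ hF hnd p v (complexStructure p u)
  rw [complexStructure_complexStructure, map_neg, dirDeriv_conjCoords hπ hF] at h
  linarith

include hπ hF hnd in
lemma specialMetric_complexStructure_left (p : M) (v u : TangentSpace 𝓘(ℝ, Fin n → ℂ) p) :
    specialMetric π F p (complexStructure p v) u
      = -2 * stdSymplectic n (dirDeriv (affineCoords π F) p v)
        (dirDeriv (affineCoords π F) p u) := by
  have h := specialMetric_hermitian hπ hF p (complexStructure p v) u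
  rw [complexStructure_complexStructure, map_neg, LinearMap.neg_apply] at h
  rw [← h, specialMetric_complexStructure hπ hF hnd]
  ring

include hπ hF hnd in
lemma specialMetric_symm (p : M) (v u : TangentSpace 𝓘(ℝ, Fin n → ℂ) p) :
    specialMetric π F p v u = specialMetric π F p u v := by
  have key (u : TangentSpace 𝓘(ℝ, Fin n → ℂ) p) :
      specialMetric π F p v (complexStructure p u)
        = specialMetric π F p (complexStructure p u) v := by
    rw [specialMetric_complexStructure hπ hF hnd, specialMetric_complexStructure_left hπ hF hnd,
      stdSymplectic_swap]
    ring
  -- By J² = -1 every vector is, up to sign, of the form Ju, so `key` covers all pairs.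
  have h := key (complexStructure p u)
  rw [complexStructure_complexStructure, map_neg, map_neg, LinearMap.neg_apply] at h
  exact neg_injective h

include hπ hF hnd in
lemma specialMetric_skew (p : M) (v u : TangentSpace 𝓘(ℝ, Fin n → ℂ) p) :
    specialMetric π F p (complexStructure p v) u
      = -specialMetric π F p v (complexStructure p u) := by
  rw [specialMetric_complexStructure_left hπ hF hnd, specialMetric_complexStructure hπ hF hnd]
  ring

include hπ hF hnd in
lemma isPseudoMetric_specialMetric : IsPseudoMetric (specialMetric π F) where
  smooth p X Y hX hY := by
    simp only [specialMetric_eq hπ hF hnd]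
    have hΦ := isDevelopingMap_affineCoords hπ hF hnd
    refine contMDiffAt_const.mul ?_
    exact ((stdSymplectic n).contMDiff.contMDiffAt.comp p
      (contMDiffAt_dirDeriv (hΦ.smooth p) hX)).clm_apply
      (contMDiffAt_dirDeriv (contMDiff_conjCoords hπ hF p) hY)
  symm := specialMetric_symm hπ hF hnd
  nondegenerate p := by
    have hΦ := isDevelopingMap_affineCoords hπ hF hnd
    have hl : ∀ v : TangentSpace 𝓘(ℝ, Fin n → ℂ) p, (∀ u, specialMetric π F p v u = 0) → v = 0 := by
      intro v hv
      apply hΦ.dirDeriv_injective p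
      rw [dirDeriv_map_zero]
      refine eq_zero_of_stdSymplectic_eq_zero fun b ↦ ?_
      -- Testing `v` against J(dΦ)⁻¹b gives 2σ(dΦ v, b), so nondegeneracy of g reduces to that of σ.
      have h := specialMetric_complexStructure hπ hF hnd p v
        ((mvfderiv 𝓘(ℝ, Fin n → ℂ) (affineCoords π F) p).inverse b)
      rw [hv, hΦ.dirDeriv_inverse] at h
      linarith
    exact ⟨hl, fun v hv ↦ hl v fun u ↦ by rw [specialMetric_symm hπ hF hnd, hv]⟩

include hπ hF hnd in
lemma isAlmostComplex_complexStructure :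
    IsAlmostComplex (complexStructure : EndoField (Fin n → ℂ) M) where
  smooth p X hX := by
    rw [(isDevelopingMap_affineCoords hπ hF hnd).smoothAt_iff]
    simp only [dirDeriv_conjCoords hπ hF]
    exact contMDiffAt_dirDeriv (contMDiff_conjCoords hπ hF p) hX
  sq := complexStructure_complexStructure

lemma isIntegrableComplex_complexStructure :
    IsIntegrableComplex (complexStructure : EndoField (Fin n → ℂ) M) := by
  intro p
  refine ⟨n, chartAt (Fin n → ℂ) p, mem_chart_source _ p, contMDiffOn_chart, contMDiffOn_chart_symm,
    fun q hq v ↦ dirDeriv_complexStructure ?_ v⟩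
  have h := (contMDiffOn_chart (I := 𝓘(ℂ, Fin n → ℂ)) (n := ω) (x := p)).contMDiffAt
    ((chartAt (Fin n → ℂ) p).open_source.mem_nhds hq)
  exact h.mdifferentiableAt (by simp)

include hπ hF hnd in
lemma isParallelBilin_fundamentalForm :
    IsParallelBilin (isDevelopingMap_affineCoords hπ hF hnd).connection
      (fundamentalForm complexStructure (specialMetric π F)) := by
  refine (isDevelopingMap_affineCoords hπ hF hnd).isParallelBilin ((-2 : ℝ) • stdSymplectic n)
    fun p v u ↦ ?_
  exact specialMetric_complexStructure_left hπ hF hnd p v u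

include hπ hF hnd in
lemma isPseudoKaehler_specialMetric : IsPseudoKaehler complexStructure (specialMetric π F) where
  almostComplex := isAlmostComplex_complexStructure hπ hF hnd
  integrable := isIntegrableComplex_complexStructure
  metric := isPseudoMetric_specialMetric hπ hF hnd
  hermitian := specialMetric_hermitian hπ hF
  closed := by
    refine (isDevelopingMap_affineCoords hπ hF hnd).isClosedTwoForm
      (isParallelBilin_fundamentalForm hπ hF hnd) fun p v u ↦ ?_
    refine (specialMetric_complexStructure_left hπ hF hnd p v u).trans ?_
    rw [stdSymplectic_swap, mul_neg]
    exact congrArg _ (specialMetric_complexStructure_left hπ hF hnd p u v).symm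

include hπ hF hnd in
lemma isSpecialKaehler_specialMetric : IsSpecialKaehler complexStructure (specialMetric π F)
    (isDevelopingMap_affineCoords hπ hF hnd).connection where
  pseudoKaehler := isPseudoKaehler_specialMetric hπ hF hnd
  smooth := (isDevelopingMap_affineCoords hπ hF hnd).contMDiffCovariantDerivative
  torsionFree := (isDevelopingMap_affineCoords hπ hF hnd).torsion_eq_zero
  flat := (isDevelopingMap_affineCoords hπ hF hnd).isFlatConnection
  nablaJ_symm p X Y hX hY := by
    have hΦ := isDevelopingMap_affineCoords hπ hF hnd
    have hb := hΦ.connection_sub X Y hX hY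
    -- Since dΦ(JY) = dΨ(Y), the commutator identity for Ψ reads ∇_X(JY) - ∇_Y(JX) = J[X,Y], and
    -- [X,Y] = ∇_X Y - ∇_Y X.
    have h := dirDeriv_dirDeriv_sub (contMDiff_conjCoords hπ hF p) hX hY
    rw [← hb, ← dirDeriv_conjCoords hπ hF] at h
    simp only [← dirDeriv_conjCoords hπ hF] at h
    rw [← hΦ.dirDeriv_connection (fun q ↦ complexStructure q (Y q)),
      ← hΦ.dirDeriv_connection (fun q ↦ complexStructure q (X q)), ← dirDeriv_map_sub] at h
    have h2 := hΦ.dirDeriv_injective p h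
    rw [map_sub] at h2
    rw [sub_eq_sub_iff_sub_eq_sub]
    exact h2
  parallel := isParallelBilin_fundamentalForm hπ hF hnd

end SpecialKaehler

/-! ### Maps with one appended coordinate. -/

section Snoc

variable {V : Type*} [NormedAddCommGroup V] [NormedSpace ℝ V]
  {M : Type*} [TopologicalSpace M] [ChartedSpace V M] {m : ℕ}

lemma contMDiffAt_snoc {f : M → Fin m → ℝ} {h : M → ℝ} {p : M}
    (hf : ContMDiffAt 𝓘(ℝ, V) 𝓘(ℝ, Fin m → ℝ) ∞ f p)
    (hh : ContMDiffAt 𝓘(ℝ, V) 𝓘(ℝ, ℝ) ∞ h p) :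
    ContMDiffAt 𝓘(ℝ, V) 𝓘(ℝ, Fin (m + 1) → ℝ) ∞
      (fun p ↦ (Fin.snoc (f p) (h p) : Fin (m + 1) → ℝ)) p := by
  refine contMDiffAt_pi_space.2 fun k ↦ ?_
  refine Fin.lastCases ?_ (fun i ↦ ?_) k
  · simpa only [Fin.snoc_last] using hh
  · simpa only [Fin.snoc_castSucc] using contMDiffAt_pi_space.1 hf i

lemma dirDeriv_snoc {f : M → Fin m → ℝ} {h : M → ℝ} {p : M}
    (hf : ContMDiffAt 𝓘(ℝ, V) 𝓘(ℝ, Fin m → ℝ) ∞ f p)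
    (hh : ContMDiffAt 𝓘(ℝ, V) 𝓘(ℝ, ℝ) ∞ h p) (v : TangentSpace 𝓘(ℝ, V) p) :
    dirDeriv (fun p ↦ (Fin.snoc (f p) (h p) : Fin (m + 1) → ℝ)) p v
      = (Fin.snoc (dirDeriv f p v) (dirDeriv h p v) : Fin (m + 1) → ℝ) := by
  ext k
  rw [dirDeriv_apply ((contMDiffAt_snoc hf hh).mdifferentiableAt (by simp))]
  refine Fin.lastCases ?_ (fun i ↦ ?_) k
  · simp only [Fin.snoc_last]
  · simp only [Fin.snoc_castSucc, dirDeriv_apply (hf.mdifferentiableAt (by simp))]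

end Snoc

/-! ### The height function and the Gauss equation. -/

section Hypersurface

variable {n : ℕ} {M : Type*} [TopologicalSpace M] [ChartedSpace (Fin n → ℂ) M]
  [IsManifold 𝓘(ℂ, Fin n → ℂ) ω M] {π : M → Fin n → ℂ} {F : M → ℂ}

/-- The last component of the map `φ_F`. -/
def height (π : M → Fin n → ℂ) (F : M → ℂ) (p : M) : ℝ :=
  2 * (F p).im - 2 * ∑ k, (partialDeriv π F k p).re * (π p k).im

variable (hπ : IsLocalDiffeomorph 𝓘(ℂ, Fin n → ℂ) 𝓘(ℂ, Fin n → ℂ) ω π)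
  (hF : ContMDiff 𝓘(ℂ, Fin n → ℂ) 𝓘(ℂ, ℂ) ω F) (hnd : IsNondegenerate π F)

include hπ hF in
lemma contMDiff_height : ContMDiff 𝓘(ℝ, Fin n → ℂ) 𝓘(ℝ, ℝ) ∞ (height π F) := by
  refine (contMDiff_const.mul (Complex.imCLM.contMDiff.comp (contMDiff_real_of_complex hF))).sub
    (contMDiff_const.mul (contMDiff_finsetSum fun k _ ↦ ?_))
  exact (contMDiff_yCoord hπ hF k).mul
    (Complex.imCLM.contMDiff.comp (contMDiff_real_component hπ k))

-- From dF = ∑ w̃ dz̃, the term Re w̃ · Im dz̃ of Im dF cancels against the derivative of the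
-- correction ∑ Re w̃ · Im z̃. What remains is 2∑ (Im w̃ · Re dz̃ - Im z̃ · Re dw̃).
include hπ hF in
lemma dirDeriv_height (p : M) (v : TangentSpace 𝓘(ℝ, Fin n → ℂ) p) :
    dirDeriv (height π F) p v
      = 2 * stdSymplectic n (conjCoords π F p) (dirDeriv (affineCoords π F) p v) := by
  have hFp := (Complex.imCLM.contMDiff.comp (contMDiff_real_of_complex hF) p).mdifferentiableAt
    (by simp)
  have him := fun k ↦ (Complex.imCLM.contMDiff.comp
    (contMDiff_real_component hπ k) p).mdifferentiableAt (by simp)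
  have hy := fun k ↦ (contMDiff_yCoord hπ hF k p).mdifferentiableAt (by simp)
  have hs := fun k ↦ mdifferentiableAt_fun_mul (hy k) (him k)
  have hheight : height π F = fun q ↦ ((2 : ℝ) • ContinuousLinearMap.id ℝ ℝ)
      ((F q).im - ∑ k, yCoord π F k q * (π q k).im) := by
    ext q
    simp [height, yCoord, mul_sub]
  rw [hheight]
  refine (dirDeriv_clm_comp _ (hFp.sub (mdifferentiableAt_fun_sum fun k _ ↦ hs k)) v).trans ?_
  have h1 : dirDeriv (fun q ↦ (F q).im - ∑ k, yCoord π F k q * (π q k).im) p v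
      = (dirDeriv F p v).im - ∑ k, (yCoord π F k p * (dirDeriv (fun q ↦ π q k) p v).im
        + dirDeriv (yCoord π F k) p v * (π p k).im) := by
    refine (dirDeriv_fun_sub hFp (mdifferentiableAt_fun_sum fun k _ ↦ hs k) v).trans ?_
    refine congrArg₂ _
      (dirDeriv_im ((contMDiff_real_of_complex hF p).mdifferentiableAt (by simp)) v) ?_
    refine (dirDeriv_fun_sum (fun k _ ↦ hs k) v).trans (Finset.sum_congr rfl fun k _ ↦ ?_)
    refine (dirDeriv_fun_mul (hy k) (him k) v).trans ?_
    congr 2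
    exact dirDeriv_im ((contMDiff_real_component hπ k p).mdifferentiableAt (by simp)) v
  refine (congrArg _ h1).trans ?_
  rw [dirDeriv_eq_sum_component hπ hF, Complex.im_sum, ← Finset.sum_sub_distrib,
    stdSymplectic_apply, dirDeriv_affineCoords hπ hF]
  simp only [smul_apply, ContinuousLinearMap.id_apply, smul_eq_mul]
  refine congrArg _ (Finset.sum_congr rfl fun k _ ↦ ?_)
  rw [conjCoords, Fin.append_left, Fin.append_right, Fin.append_left, Fin.append_right,
    dirDeriv_yCoord hπ hF, dirDeriv_apply ((contMDiff_real_proj hπ p).mdifferentiableAt (by simp)),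
    Complex.mul_im, yCoord]
  ring

include hπ hF in
lemma contMDiff_phiF : ContMDiff 𝓘(ℝ, Fin n → ℂ) 𝓘(ℝ, Fin (n + n + 1) → ℝ) ∞ (phiF π F) :=
  fun p ↦ contMDiffAt_snoc (contMDiff_append (contMDiff_xCoord hπ) (contMDiff_yCoord hπ hF) p)
    (contMDiff_height hπ hF p)

include hπ hF in
lemma dirDeriv_phiF (p : M) (v : TangentSpace 𝓘(ℝ, Fin n → ℂ) p) :
    dirDeriv (phiF π F) p v
      = (Fin.snoc (dirDeriv (affineCoords π F) p v) (dirDeriv (height π F) p v) :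
        Fin (n + n + 1) → ℝ) :=
  dirDeriv_snoc
    (contMDiff_append (contMDiff_xCoord hπ) (contMDiff_yCoord hπ hF) p)
    (contMDiff_height hπ hF p) v

-- The ∇-Hessian of the height is g: in the product rule for 2σ(Ψ, dΦ(Y)), one term is dh(∇_v Y) and
-- the other is 2σ(dΨ v, dΦ Y) = g(v, Y).
include hπ hF in
lemma dirDeriv_dirDeriv_height {p : M} {Y : VField (Fin n → ℂ) M} (hY : Y.SmoothAt p)
    (v : TangentSpace 𝓘(ℝ, Fin n → ℂ) p) (hnd : IsNondegenerate π F) :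
    dirDeriv (fun q ↦ dirDeriv (height π F) q (Y q)) p v
      = dirDeriv (height π F) p ((isDevelopingMap_affineCoords hπ hF hnd).connection Y p v)
        + specialMetric π F p v (Y p) := by
  have hΦ := isDevelopingMap_affineCoords hπ hF hnd
  simp only [dirDeriv_height hπ hF]
  have h := dirDeriv_bilin ((2 : ℝ) • stdSymplectic n)
    ((contMDiff_conjCoords hπ hF p).mdifferentiableAt (by simp))
    ((contMDiffAt_dirDeriv (hΦ.smooth p) hY).mdifferentiableAt (by simp)) v
  refine h.trans ?_
  have hg := specialMetric_complexStructure_left hπ hF hnd p (complexStructure p v) (Y p)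
  rw [complexStructure_complexStructure, map_neg, LinearMap.neg_apply,
    dirDeriv_conjCoords hπ hF] at hg
  rw [hΦ.dirDeriv_connection]
  simp only [smul_apply, smul_eq_mul]
  linarith

include hπ hF in
lemma gauss_phiF (hnd : IsNondegenerate π F) {p : M} {Y : VField (Fin n → ℂ) M}
    (hY : Y.SmoothAt p) (v : TangentSpace 𝓘(ℝ, Fin n → ℂ) p) :
    dirDeriv (fun q ↦ dirDeriv (phiF π F) q (Y q)) p v
      = dirDeriv (phiF π F) p ((isDevelopingMap_affineCoords hπ hF hnd).connection Y p v)
        + specialMetric π F p v (Y p) •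
          (Pi.single (Fin.last (n + n)) 1 : Fin (n + n + 1) → ℝ) := by
  have hΦ := isDevelopingMap_affineCoords hπ hF hnd
  simp only [dirDeriv_phiF hπ hF]
  rw [dirDeriv_snoc (contMDiffAt_dirDeriv (hΦ.smooth p) hY)
    (contMDiffAt_dirDeriv (contMDiff_height hπ hF p) hY),
    dirDeriv_dirDeriv_height hπ hF hY v hnd, hΦ.dirDeriv_connection]
  ext k
  refine Fin.lastCases ?_ (fun i ↦ ?_) k
  · simp
  · simp [Fin.ext_iff, i.2.ne]

end Hypersurface

/-! ### Determinants for the volume form. -/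

section Determinants

/-- Expansion along the first row; the appended entries `h` lie in the deleted column. The sign is 1
in the application, where m = 2n. -/
lemma det_cons_last_snoc {m : ℕ} (a : Fin m → Fin m → ℝ) (h : Fin m → ℝ) :
    (Pi.basisFun ℝ (Fin (m + 1))).det (Matrix.vecCons (Pi.single (Fin.last m) 1)
      (fun i ↦ (Fin.snoc (a i) (h i) : Fin (m + 1) → ℝ)))
      = (-1) ^ m * (Pi.basisFun ℝ (Fin m)).det a := by
  rw [Pi.basisFun_det_apply, Pi.basisFun_det_apply, Matrix.det_succ_row_zero,
    Finset.sum_eq_single (Fin.last m)]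
  · have : ((Matrix.of (Matrix.vecCons (Pi.single (Fin.last m) 1)
        (fun i ↦ (Fin.snoc (a i) (h i) : Fin (m + 1) → ℝ)))).submatrix Fin.succ
          (Fin.last m).succAbove) = Matrix.of a := by
      ext i j
      simp
    rw [this]
    simp
  · intro j _ hj
    simp [hj]
  · simp

/-- The square of the determinant is det(-1), which is 1 in even dimension. It applies both to J and
to the matrix of σ. -/
lemma abs_det_eq_one_of_comp_self {m : ℕ} {f : (Fin (m + m) → ℝ) →ₗ[ℝ] Fin (m + m) → ℝ}
    (hf : ∀ a, f (f a) = -a) : |LinearMap.det f| = 1 := by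
  have h : f * f = -1 := LinearMap.ext hf
  have h2 := congrArg LinearMap.det h
  rw [map_mul] at h2
  have h3 : LinearMap.det (-1 : (Fin (m + m) → ℝ) →ₗ[ℝ] Fin (m + m) → ℝ) = 1 := by
    rw [← neg_one_smul ℝ, LinearMap.det_smul]
    simp [← two_mul]
  rw [h3] at h2
  rcases mul_self_eq_one_iff.1 h2 with h | h <;> simp [h]

/-- The endomorphism of `ℝ^{2n}` which represents the standard symplectic form. -/
def symplecticEndo (n : ℕ) : (Fin (n + n) → ℝ) →ₗ[ℝ] Fin (n + n) → ℝ where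
  toFun b := Fin.append (fun i ↦ b (Fin.natAdd n i)) (fun i ↦ -b (Fin.castAdd n i))
  map_add' a b := by
    ext k
    refine Fin.addCases (fun i ↦ ?_) (fun i ↦ ?_) k
    · simp only [Fin.append_left, Pi.add_apply]
    · simp only [Fin.append_right, Pi.add_apply, neg_add]
  map_smul' c a := by
    ext k
    refine Fin.addCases (fun i ↦ ?_) (fun i ↦ ?_) k
    · simp only [Fin.append_left, Pi.smul_apply, RingHom.id_apply]
    · simp only [Fin.append_right, Pi.smul_apply, RingHom.id_apply, smul_neg]

lemma symplecticEndo_apply {n : ℕ} (b : Fin (n + n) → ℝ) : symplecticEndo n b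
    = Fin.append (fun i ↦ b (Fin.natAdd n i)) (fun i ↦ -b (Fin.castAdd n i)) := rfl

lemma symplecticEndo_symplecticEndo {n : ℕ} (b : Fin (n + n) → ℝ) :
    symplecticEndo n (symplecticEndo n b) = -b := by
  ext k
  rw [symplecticEndo_apply, symplecticEndo_apply]
  refine Fin.addCases (fun i ↦ ?_) (fun i ↦ ?_) k
  · simp only [Fin.append_left, Fin.append_right, Pi.neg_apply]
  · simp only [Fin.append_left, Fin.append_right, Pi.neg_apply]

lemma stdSymplectic_eq_dotProduct {n : ℕ} (a b : Fin (n + n) → ℝ) :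
    stdSymplectic n a b = a ⬝ᵥ symplecticEndo n b := by
  rw [stdSymplectic_apply, dotProduct, Fin.sum_univ_add, ← Finset.sum_add_distrib]
  refine Finset.sum_congr rfl fun i _ ↦ ?_
  rw [symplecticEndo_apply, Fin.append_left, Fin.append_right]
  ring

end Determinants

/-! ### The frame and orientation given by a developing map. -/

section Developing

variable {V : Type*} [NormedAddCommGroup V] [NormedSpace ℝ V] [CompleteSpace V]
  {M : Type*} [TopologicalSpace M] [ChartedSpace V M] [IsManifold 𝓘(ℝ, V) ∞ M]
  {m : ℕ} {Φ : M → Fin m → ℝ}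

namespace IsDevelopingMap

variable (hΦ : IsDevelopingMap V Φ)

/-- The derivative of a developing map as a linear equivalence. -/
def tangentEquiv (p : M) : TangentSpace 𝓘(ℝ, V) p ≃ₗ[ℝ] Fin m → ℝ :=
  { (mvfderiv 𝓘(ℝ, V) Φ p).toLinearMap with
    invFun := (mvfderiv 𝓘(ℝ, V) Φ p).inverse
    left_inv := hΦ.inverse_dirDeriv p
    right_inv := hΦ.dirDeriv_inverse p }

/-- The basis of the tangent space which a developing map sends to the standard basis. -/
def frameBasis (p : M) : Module.Basis (Fin m) ℝ (TangentSpace 𝓘(ℝ, V) p) :=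
  (Pi.basisFun ℝ (Fin m)).map (hΦ.tangentEquiv p).symm

/-- The orientation for which a developing map is orientation preserving. -/
def orientation : ManifoldOrientation V M m where
  at_ p := (hΦ.frameBasis p).orientation
  exists_frame p := ⟨fun i ↦ frameField V Φ (Pi.single i 1), fun i ↦ hΦ.smoothAt_frameField _ p,
    Filter.Eventually.of_forall fun q ↦ ⟨hΦ.frameBasis q, fun i ↦ by
      rw [frameBasis, Module.Basis.map_apply, Pi.basisFun_apply]; rfl, rfl⟩⟩

lemma det_pos_of_orientation_eq {p : M} {b : Module.Basis (Fin m) ℝ (TangentSpace 𝓘(ℝ, V) p)}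
    (hb : b.orientation = hΦ.orientation.at_ p) :
    0 < (Pi.basisFun ℝ (Fin m)).det (fun i ↦ dirDeriv Φ p (b i)) := by
  have h := (Module.Basis.orientation_eq_iff_det_pos _ _).1 hb.symm
  rw [frameBasis, Module.Basis.det_map] at h
  exact h

end IsDevelopingMap

end Developing

/-! ### The volume condition and the hypersphere φ_F. -/

section Hypersurface

variable {n : ℕ} {M : Type*} [TopologicalSpace M] [ChartedSpace (Fin n → ℂ) M]
  [IsManifold 𝓘(ℂ, Fin n → ℂ) ω M] {π : M → Fin n → ℂ} {F : M → ℂ}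

variable (hπ : IsLocalDiffeomorph 𝓘(ℂ, Fin n → ℂ) 𝓘(ℂ, Fin n → ℂ) ω π)
  (hF : ContMDiff 𝓘(ℂ, Fin n → ℂ) 𝓘(ℂ, ℂ) ω F) (hnd : IsNondegenerate π F)

-- From g(v, u) = 2σ(dΦ(Jv), dΦ(u)) the Gram matrix is twice a product of the matrices of f ∘ N and
-- S ∘ N, where f is J transported by dΦ and S represents σ. Both f and S have determinant ±1, and
-- the scalar contributes 2²ⁿ.
include hπ hF hnd in
lemma abs_det_specialMetric {p : M} (b : Fin (n + n) → TangentSpace 𝓘(ℝ, Fin n → ℂ) p) :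
    |(Matrix.of fun i j ↦ specialMetric π F p (b i) (b j)).det|
      = (2 ^ n * (Pi.basisFun ℝ (Fin (n + n))).det
        (fun i ↦ dirDeriv (affineCoords π F) p (b i))) ^ 2 := by
  have hΦ := isDevelopingMap_affineCoords hπ hF hnd
  let f : (Fin (n + n) → ℝ) →ₗ[ℝ] Fin (n + n) → ℝ :=
    (hΦ.tangentEquiv p).toLinearMap ∘ₗ complexStructure p ∘ₗ (hΦ.tangentEquiv p).symm.toLinearMap
  have hf (v : TangentSpace 𝓘(ℝ, Fin n → ℂ) p) : f (dirDeriv (affineCoords π F) p v)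
      = dirDeriv (affineCoords π F) p (complexStructure p v) :=
    congrArg (fun u ↦ dirDeriv (affineCoords π F) p (complexStructure p u))
      ((hΦ.tangentEquiv p).symm_apply_apply v)
  have hff (a) : f (f a) = -a := by
    obtain ⟨v, rfl⟩ : ∃ v, dirDeriv (affineCoords π F) p v = a :=
      ⟨_, hΦ.dirDeriv_inverse p a⟩
    rw [hf, hf, complexStructure_complexStructure, dirDeriv_map_neg]
  set N : Fin (n + n) → Fin (n + n) → ℝ := fun i ↦ dirDeriv (affineCoords π F) p (b i)
  have hG : (Matrix.of fun i j ↦ specialMetric π F p (b i) (b j))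
      = (2 : ℝ) • (Matrix.of (f ∘ N) * (Matrix.of (symplecticEndo n ∘ N)).transpose) := by
    ext i j
    have hg := specialMetric_complexStructure_left hπ hF hnd p (complexStructure p (b i)) (b j)
    rw [complexStructure_complexStructure, map_neg, LinearMap.neg_apply, ← hf,
      stdSymplectic_eq_dotProduct] at hg
    simp only [Matrix.smul_apply, Matrix.of_apply, Matrix.mul_apply', smul_eq_mul]
    refine neg_injective (hg.trans ?_)
    rw [neg_mul]
    rfl
  have h1 : (Matrix.of (f ∘ N)).det = LinearMap.det f * (Matrix.of N).det := by
    rw [← Pi.basisFun_det_apply, ← Pi.basisFun_det_apply, Module.Basis.det_comp]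
  have h2 : (Matrix.of (symplecticEndo n ∘ N)).det
      = LinearMap.det (symplecticEndo n) * (Matrix.of N).det := by
    rw [← Pi.basisFun_det_apply, ← Pi.basisFun_det_apply, Module.Basis.det_comp]
  rw [hG, Matrix.det_smul, Matrix.det_mul, Matrix.det_transpose, h1, h2, Pi.basisFun_det_apply]
  simp only [abs_mul, abs_det_eq_one_of_comp_self hff,
    abs_det_eq_one_of_comp_self symplecticEndo_symplecticEndo, one_mul, abs_mul_abs_self]
  simp [pow_add]
  ring

include hπ hF in
lemma inducedForm_phiF (p : M) (v : Fin (n + n) → TangentSpace 𝓘(ℝ, Fin n → ℂ) p) :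
    inducedForm (standardVol n) (phiF π F) (fun _ ↦ Pi.single (Fin.last (n + n)) 1) p v
      = 2 ^ n * (Pi.basisFun ℝ (Fin (n + n))).det
        (fun i ↦ dirDeriv (affineCoords π F) p (v i)) := by
  have h : (fun i ↦ dirDeriv (phiF π F) p (v i)) = fun i ↦
      (Fin.snoc (dirDeriv (affineCoords π F) p (v i)) (dirDeriv (height π F) p (v i)) :
        Fin (n + n + 1) → ℝ) := funext fun i ↦ dirDeriv_phiF hπ hF p (v i)
  have h2 := det_cons_last_snoc (fun i ↦ dirDeriv (affineCoords π F) p (v i))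
    (fun i ↦ dirDeriv (height π F) p (v i))
  rw [← h, Even.neg_one_pow ⟨n, rfl⟩, one_mul] at h2
  exact congrArg (2 ^ n * ·) h2

include hπ hF hnd in
lemma isParallelForm_inducedForm_phiF :
    IsParallelForm (isDevelopingMap_affineCoords hπ hF hnd).connection
      (inducedForm (V := Fin n → ℂ) (standardVol n) (phiF π F)
        (fun _ ↦ Pi.single (Fin.last (n + n)) 1)) := by
  refine IsDevelopingMap.isParallelForm _ ((2 : ℝ) ^ n • (Pi.basisFun ℝ (Fin (n + n))).det) ?_
    fun p v ↦ inducedForm_phiF hπ hF p v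
  refine continuous_const.mul ?_
  have h : Continuous fun v : Matrix (Fin (n + n)) (Fin (n + n)) ℝ ↦ v.det :=
    Continuous.matrix_det continuous_id
  exact h.congr fun v ↦ (Pi.basisFun_det_apply v).symm

include hπ hF hnd in
lemma isMetricVolumeForm_inducedForm_phiF :
    IsMetricVolumeForm (isDevelopingMap_affineCoords hπ hF hnd).orientation (specialMetric π F)
      (inducedForm (V := Fin n → ℂ) (standardVol n) (phiF π F)
        (fun _ ↦ Pi.single (Fin.last (n + n)) 1)) := by
  intro p b hb
  rw [inducedForm_phiF hπ hF, abs_det_specialMetric hπ hF hnd, Real.sqrt_sq]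
  have := IsDevelopingMap.det_pos_of_orientation_eq _ hb
  positivity

include hπ hF hnd in
lemma isCompatibleComplex_complexStructure :
    IsCompatibleComplex complexStructure (specialMetric π F)
      (isDevelopingMap_affineCoords hπ hF hnd).connection where
  almostComplex := isAlmostComplex_complexStructure hπ hF hnd
  skew := specialMetric_skew hπ hF hnd
  parallel := isParallelBilin_fundamentalForm hπ hF hnd

include hπ hF hnd in
lemma isBlaschkeHypersurface_phiF (hn : 0 < n) :
    IsBlaschkeHypersurface (standardVol n) (isDevelopingMap_affineCoords hπ hF hnd).orientation
      (phiF π F) (fun _ ↦ Pi.single (Fin.last (n + n)) 1) (specialMetric π F)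
      (isDevelopingMap_affineCoords hπ hF hnd).connection where
  one_lt := by omega
  finrank_eq := by simp [Module.finrank_pi_fintype, mul_two]
  smooth := contMDiff_phiF hπ hF
  immersion p v u h := by
    refine (isDevelopingMap_affineCoords hπ hF hnd).dirDeriv_injective p ?_
    have h' : dirDeriv (phiF π F) p v = dirDeriv (phiF π F) p u := h
    rw [dirDeriv_phiF hπ hF, dirDeriv_phiF hπ hF] at h'
    ext k
    simpa only [Fin.snoc_castSucc] using congrFun h' k.castSucc
  smooth_normal := contMDiff_const
  transversal := by
    rintro p ⟨v, hv⟩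
    have h' : dirDeriv (phiF π F) p v = Pi.single (Fin.last (n + n)) 1 := hv
    have hv0 : v = 0 := by
      refine (isDevelopingMap_affineCoords hπ hF hnd).dirDeriv_injective p ?_
      rw [dirDeriv_map_zero]
      rw [dirDeriv_phiF hπ hF] at h'
      ext k
      have := congrFun h' k.castSucc
      rw [Fin.snoc_castSucc] at this
      rw [this]
      simp [Fin.ext_iff, k.2.ne]
    rw [hv0, dirDeriv_map_zero] at h'
    simpa using congrFun h' (Fin.last _)
  gauss p v Y hY := gauss_phiF hπ hF hnd hY v
  metric := isPseudoMetric_specialMetric hπ hF hnd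
  volume_eq := isMetricVolumeForm_inducedForm_phiF hπ hF hnd
  volume_parallel := isParallelForm_inducedForm_phiF hπ hF hnd

include hπ hF hnd in
lemma isSpecialParabolicHypersphere_phiF (hn : 0 < n) :
    IsSpecialParabolicHypersphere (standardVol n)
      (isDevelopingMap_affineCoords hπ hF hnd).orientation
      (phiF π F) (fun _ ↦ Pi.single (Fin.last (n + n)) 1) (specialMetric π F)
      (isDevelopingMap_affineCoords hπ hF hnd).connection complexStructure where
  blaschke := isBlaschkeHypersurface_phiF hπ hF hnd hn
  parabolic p v := dirDeriv_const _ p v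
  compatible := isCompatibleComplex_complexStructure hπ hF hnd

end Hypersurface

/-! ### Uniqueness up to unimodular affine maps. -/

section Uniqueness

variable {V : Type*} [NormedAddCommGroup V] [NormedSpace ℝ V]
  {M : Type*} [TopologicalSpace M] [ChartedSpace V M] [IsManifold 𝓘(ℝ, V) ∞ M] {m : ℕ}

/-- Adjusting a basis to the orientation changes it by determinant ±1, which alters neither |ν| nor
|det g|. This allows a comparison of hypersurfaces with different orientations. -/
lemma IsMetricVolumeForm.abs_apply [Nonempty (Fin m)] {o : ManifoldOrientation V M m}
    {g : BilinField V M} {ν : FormField V M m} (hν : IsMetricVolumeForm o g ν) (p : M)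
    (b : Module.Basis (Fin m) ℝ (TangentSpace 𝓘(ℝ, V) p)) :
    |ν p b| = √|(Matrix.of fun i j ↦ g p (b i) (b j)).det| := by
  have hmat (c : Module.Basis (Fin m) ℝ (TangentSpace 𝓘(ℝ, V) p)) :
      (Matrix.of fun i j ↦ g p (c i) (c j)) = LinearMap.BilinForm.toMatrix c (g p) := by
    ext i j
    rw [LinearMap.BilinForm.toMatrix_apply]
    rfl
  let c := b.adjustToOrientation (o.at_ p)
  have hc := hν p c (b.orientation_adjustToOrientation (o.at_ p))
  have hbc : |b.det c| = 1 := by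
    rw [← b.abs_det_adjustToOrientation (o.at_ p) c, Module.Basis.det_self, abs_one]
  have hG : |(Matrix.of fun i j ↦ g p (c i) (c j)).det|
      = |(Matrix.of fun i j ↦ g p (b i) (b j)).det| := by
    rw [hmat, hmat, ← LinearMap.BilinForm.toMatrix_mul_basis_toMatrix b c, Matrix.det_mul,
      Matrix.det_mul, Matrix.det_transpose, ← Module.Basis.det_apply, abs_mul, abs_mul, hbc,
      one_mul, mul_one]
  have h1 : ν p c = ν p b * b.det c :=
    congrArg (fun f : (TangentSpace 𝓘(ℝ, V) p) [⋀^Fin m]→ₗ[ℝ] ℝ ↦ f c)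
      ((ν p).eq_smul_basis_det b)
  have h2 := congrArg abs h1
  rw [abs_mul, hbc, mul_one] at h2
  rw [← h2, hc, hG, abs_of_nonneg (Real.sqrt_nonneg _)]

lemma IsPseudoMetric.det_ne_zero {g : BilinField V M} (hg : IsPseudoMetric g) (p : M)
    (b : Module.Basis (Fin m) ℝ (TangentSpace 𝓘(ℝ, V) p)) :
    (Matrix.of fun i j ↦ g p (b i) (b j)).det ≠ 0 := by
  have h := (LinearMap.BilinForm.nondegenerate_iff_det_ne_zero b).1 (hg.nondegenerate p)
  convert h using 2
  ext i j
  rw [LinearMap.BilinForm.toMatrix_apply]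
  rfl

/-- Two families of vectors with nonzero determinant differ by a linear automorphism. -/
lemma exists_linearEquiv_of_det_ne_zero {E ι : Type*} [AddCommGroup E] [Module ℝ E] [Fintype ι]
    [DecidableEq ι] (e : Module.Basis ι ℝ E) {v w : ι → E} (hv : e.det v ≠ 0) (hw : e.det w ≠ 0) :
    ∃ A : E ≃ₗ[ℝ] E, (∀ i, A (v i) = w i) ∧ LinearMap.det (A : E →ₗ[ℝ] E) * e.det v = e.det w := by
  obtain ⟨hv1, hv2⟩ := e.is_basis_iff_det.2 hv.isUnit
  obtain ⟨hw1, hw2⟩ := e.is_basis_iff_det.2 hw.isUnit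
  let bv := Module.Basis.mk hv1 hv2.ge
  let bw := Module.Basis.mk hw1 hw2.ge
  have hA (i : ι) : bv.equiv bw (Equiv.refl ι) (v i) = w i := by
    have := bv.equiv_apply i bw (Equiv.refl ι)
    simpa [bv, bw] using this
  refine ⟨bv.equiv bw (Equiv.refl ι), hA, ?_⟩
  rw [← Module.Basis.det_comp]
  exact congrArg e.det (funext hA)

variable [CompleteSpace V] [ConnectedSpace M]
  {W : Type*} [NormedAddCommGroup W] [NormedSpace ℝ W] [FiniteDimensional ℝ W]

/-- A parabolic hypersphere in an affine space of dimension `m + 1` is determined by its Blaschke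
metric and its induced connection up to unimodular affine transformations. -/
lemma IsDevelopingMap.exists_affineEquiv_of_isSpecialParabolicHypersphere {Φ : M → W}
    (hΦ : IsDevelopingMap V Φ) {c : ℝ} {o o' : ManifoldOrientation V M m}
    {φ ξ ψ η : M → Fin (m + 1) → ℝ} {g : BilinField V M} {J : EndoField V M}
    (hφ : IsSpecialParabolicHypersphere (c • (Pi.basisFun ℝ (Fin (m + 1))).det) o φ ξ g
      hΦ.connection J)
    (hψ : IsSpecialParabolicHypersphere (c • (Pi.basisFun ℝ (Fin (m + 1))).det) o' ψ η g
      hΦ.connection J) :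
    ∃ A : (Fin (m + 1) → ℝ) ≃ᵃ[ℝ] (Fin (m + 1) → ℝ),
      |LinearMap.det (A.linear : (Fin (m + 1) → ℝ) →ₗ[ℝ] (Fin (m + 1) → ℝ))| = 1 ∧
      (o' = o →
        LinearMap.det (A.linear : (Fin (m + 1) → ℝ) →ₗ[ℝ] (Fin (m + 1) → ℝ)) = 1) ∧
      ∀ p, ψ p = A (φ p) := by
  have : Nonempty (Fin m) := ⟨⟨0, zero_lt_one.trans hφ.blaschke.one_lt⟩⟩
  obtain ⟨p₀⟩ : Nonempty M := inferInstance
  -- Parabolicity and connectedness make both affine normals constant.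
  have hξ (p : M) : ξ p = ξ p₀ := eq_of_dirDeriv_eq_zero
    (hφ.blaschke.smooth_normal.mdifferentiable (by simp)) hφ.parabolic p p₀
  have hη (p : M) : η p = η p₀ := eq_of_dirDeriv_eq_zero
    (hψ.blaschke.smooth_normal.mdifferentiable (by simp)) hψ.parabolic p p₀
  obtain ⟨b, hb⟩ : ∃ b : Module.Basis (Fin m) ℝ (TangentSpace 𝓘(ℝ, V) p₀),
      b.orientation = o.at_ p₀ := by
    obtain ⟨Y, -, hY⟩ := o.exists_frame p₀
    obtain ⟨b, -, hb⟩ := hY.self_of_nhds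
    exact ⟨b, hb⟩
  have hr : 0 < √|(Matrix.of fun i j ↦ g p₀ (b i) (b j)).det| :=
    Real.sqrt_pos.2 (abs_pos.2 (hφ.blaschke.metric.det_ne_zero p₀ b))
  -- The first-order data at `p₀` of the two hypersurfaces; the volume conditions show that both
  -- families are bases, and `A` carries one to the other.
  let v : Fin (m + 1) → Fin (m + 1) → ℝ := Matrix.vecCons (ξ p₀) fun i ↦ dirDeriv φ p₀ (b i)
  let w : Fin (m + 1) → Fin (m + 1) → ℝ := Matrix.vecCons (η p₀) fun i ↦ dirDeriv ψ p₀ (b i)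
  have hv : c * (Pi.basisFun ℝ (Fin (m + 1))).det v
      = √|(Matrix.of fun i j ↦ g p₀ (b i) (b j)).det| := hφ.blaschke.volume_eq p₀ b hb
  have hw : |c * (Pi.basisFun ℝ (Fin (m + 1))).det w|
      = √|(Matrix.of fun i j ↦ g p₀ (b i) (b j)).det| := hψ.blaschke.volume_eq.abs_apply p₀ b
  have hv0 : c * (Pi.basisFun ℝ (Fin (m + 1))).det v ≠ 0 := hv ▸ hr.ne'
  have hw0 : c * (Pi.basisFun ℝ (Fin (m + 1))).det w ≠ 0 := abs_ne_zero.1 (hw ▸ hr.ne')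
  obtain ⟨A, hA, hdet⟩ := exists_linearEquiv_of_det_ne_zero (Pi.basisFun ℝ (Fin (m + 1)))
    (right_ne_zero_of_mul hv0) (right_ne_zero_of_mul hw0)
  have hdet' : LinearMap.det (A : (Fin (m + 1) → ℝ) →ₗ[ℝ] (Fin (m + 1) → ℝ))
      * (c * (Pi.basisFun ℝ (Fin (m + 1))).det v) = c * (Pi.basisFun ℝ (Fin (m + 1))).det w := by
    rw [← hdet]
    ring
  have hAξ : A (ξ p₀) = η p₀ := hA 0
  have hAb (i : Fin m) : A (dirDeriv φ p₀ (b i)) = dirDeriv ψ p₀ (b i) := hA i.succ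
  let L : (Fin (m + 1) → ℝ) →L[ℝ] (Fin (m + 1) → ℝ) := A.toContinuousLinearEquiv
  let h : M → Fin (m + 1) → ℝ := fun p ↦ ψ p - L (φ p)
  have hφs := hφ.blaschke.smooth
  have hψs := hψ.blaschke.smooth
  have hLφ : ContMDiff 𝓘(ℝ, V) 𝓘(ℝ, Fin (m + 1) → ℝ) ∞ fun p ↦ L (φ p) :=
    L.contMDiff.comp hφs
  have hh (p : M) (u : TangentSpace 𝓘(ℝ, V) p) :
      dirDeriv h p u = dirDeriv ψ p u - L (dirDeriv φ p u) := by
    rw [← dirDeriv_clm_comp L ((hφs p).mdifferentiableAt (by simp))]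
    exact dirDeriv_fun_sub ((hψs p).mdifferentiableAt (by simp))
      ((hLφ p).mdifferentiableAt (by simp)) u
  have hconst (p : M) : h p = h p₀ := by
    -- In the difference of the Gauss equations the terms g(u, Y)η and g(u, Y)A(ξ) cancel, so `h`
    -- has zero Hessian; its differential vanishes at `p₀` by the choice of `A`.
    refine hΦ.eq_of_hessian_eq_zero (h := h) (hψs.sub hLφ) (fun p u Y hY ↦ ?_) (p₀ := p₀)
      (fun u ↦ ?_) p p₀
    · have hY1 := mdifferentiableAt_dirDeriv (hφs p) (hY.mdifferentiableAt (by simp))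
      have hY2 := mdifferentiableAt_dirDeriv (hψs p) (hY.mdifferentiableAt (by simp))
      simp only [hh]
      refine (dirDeriv_fun_sub hY2 (L.mdifferentiableAt.comp p hY1) u).trans ?_
      rw [hψ.blaschke.gauss p u Y hY]
      have h1 := dirDeriv_clm_comp L hY1 u
      refine (congrArg (_ - ·) h1).trans ?_
      rw [hφ.blaschke.gauss p u Y hY, map_add, map_smul, hξ, hη, show L (ξ p₀) = η p₀ from hAξ]
      abel
    · rw [← b.sum_repr u]
      simp only [dirDeriv_map_sum, dirDeriv_map_smul]
      refine Finset.sum_eq_zero fun i _ ↦ ?_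
      rw [hh, show L (dirDeriv φ p₀ (b i)) = dirDeriv ψ p₀ (b i) from hAb i, sub_self, smul_zero]
  -- The translation part is the constant value of ψ - Aφ.
  refine ⟨A.toAffineEquiv.trans (AffineEquiv.constVAdd ℝ _ (h p₀)), ?_, fun ho ↦ ?_, fun p ↦ ?_⟩
  · change |LinearMap.det (A : (Fin (m + 1) → ℝ) →ₗ[ℝ] (Fin (m + 1) → ℝ))| = 1
    have h1 := congrArg abs hdet'
    rw [abs_mul, hw, hv, abs_of_pos hr] at h1
    exact (mul_eq_right₀ hr.ne').1 h1
  · change LinearMap.det (A : (Fin (m + 1) → ℝ) →ₗ[ℝ] (Fin (m + 1) → ℝ)) = 1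
    -- With equal orientations `b` is positive for both, so the two volumes agree including sign.
    have hw' : c * (Pi.basisFun ℝ (Fin (m + 1))).det w
        = √|(Matrix.of fun i j ↦ g p₀ (b i) (b j)).det| :=
      hψ.blaschke.volume_eq p₀ b (ho ▸ hb)
    rw [hw', hv] at hdet'
    exact (mul_eq_right₀ hr.ne').1 hdet'
  · have h1 := hconst p
    change ψ p = h p₀ + L (φ p)
    rw [← h1, sub_add_cancel]

end Uniqueness

/-! ### Affine coordinates characterize ∇; the Kähler form in these coordinates. -/

section Hypersurface

variable {n : ℕ} {M : Type*} [TopologicalSpace M] [ChartedSpace (Fin n → ℂ) M]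
  [IsManifold 𝓘(ℂ, Fin n → ℂ) ω M] {π : M → Fin n → ℂ} {F : M → ℂ}

variable (hπ : IsLocalDiffeomorph 𝓘(ℂ, Fin n → ℂ) 𝓘(ℂ, Fin n → ℂ) ω π)
  (hF : ContMDiff 𝓘(ℂ, Fin n → ℂ) 𝓘(ℂ, ℂ) ω F) (hnd : IsNondegenerate π F)

lemma isAffineFunction_xCoord (i : Fin n) :
    IsAffineFunction (isDevelopingMap_affineCoords hπ hF hnd).connection (xCoord π i) := by
  have h := (isDevelopingMap_affineCoords hπ hF hnd).isAffineFunction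
    (ContinuousLinearMap.proj (R := ℝ) (φ := fun _ ↦ ℝ) (Fin.castAdd n i))
  simpa only [ContinuousLinearMap.proj_apply, affineCoords, Fin.append_left] using h

lemma isAffineFunction_yCoord (j : Fin n) :
    IsAffineFunction (isDevelopingMap_affineCoords hπ hF hnd).connection (yCoord π F j) := by
  have h := (isDevelopingMap_affineCoords hπ hF hnd).isAffineFunction
    (ContinuousLinearMap.proj (R := ℝ) (φ := fun _ ↦ ℝ) (Fin.natAdd n j))
  simpa only [ContinuousLinearMap.proj_apply, affineCoords, Fin.append_right] using h

/-- Affinity of all components of Φ says dΦ(D_v Y) = v(dΦ(Y)), and dΦ is injective. The conclusion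
is for smooth `Y`, the fields on which `IsAffineFunction` tests. -/
lemma eq_connection_of_isAffineFunction {D : Connection (Fin n → ℂ) M}
    (hx : ∀ i, IsAffineFunction D (xCoord π i)) (hy : ∀ j, IsAffineFunction D (yCoord π F j))
    {p : M} {Y : VField (Fin n → ℂ) M} (hY : Y.SmoothAt p) :
    D Y p = (isDevelopingMap_affineCoords hπ hF hnd).connection Y p := by
  have hΦ := isDevelopingMap_affineCoords hπ hF hnd
  refine hΦ.eq_connection_of_dirDeriv_eq fun v ↦ ?_
  have hd (q : M) (u : TangentSpace 𝓘(ℝ, Fin n → ℂ) q) (k) :=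
    dirDeriv_apply ((hΦ.smooth q).mdifferentiableAt (by simp)) u k
  ext k
  rw [hd, dirDeriv_apply ((contMDiffAt_dirDeriv (hΦ.smooth p) hY).mdifferentiableAt (by simp))]
  simp only [hd]
  refine Fin.addCases (fun i ↦ ?_) (fun j ↦ ?_) k
  · simp only [affineCoords, Fin.append_left]
    exact (hx i p v Y hY).symm
  · simp only [affineCoords, Fin.append_right]
    exact (hy j p v Y hY).symm

include hπ hF hnd in
lemma kaehlerForm_specialMetric (p : M) (v w : TangentSpace 𝓘(ℝ, Fin n → ℂ) p) :
    specialMetric π F p v (complexStructure p w) =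
      2 * ∑ i, (dirDeriv (xCoord π i) p v * dirDeriv (yCoord π F i) p w
        - dirDeriv (xCoord π i) p w * dirDeriv (yCoord π F i) p v) := by
  rw [specialMetric_complexStructure hπ hF hnd, stdSymplectic_apply, dirDeriv_affineCoords hπ hF,
    dirDeriv_affineCoords hπ hF]
  simp only [Fin.append_left, Fin.append_right, dirDeriv_xCoord hπ, dirDeriv_yCoord hπ hF]

end Hypersurface

end

theorem theorem3 {n : ℕ} (hn : 0 < n)
    {M : Type*} [TopologicalSpace M] [ChartedSpace (Fin n → ℂ) M]
    [IsManifold 𝓘(ℂ, Fin n → ℂ) ω M] [ConnectedSpace M]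
    (U : Set (Fin n → ℂ)) (π : M → Fin n → ℂ) (hπ : IsRiemannDomain U π)
    (F : M → ℂ) (hF : ContMDiff 𝓘(ℂ, Fin n → ℂ) 𝓘(ℂ, ℂ) ω F) (hnd : IsNondegenerate π F) :
    ∃ D : Connection (Fin n → ℂ) M,
      -- `D` is the unique connection for which all `x̃ⁱ` and `ỹⱼ` are affine functions
      ((∀ i, IsAffineFunction D (xCoord π i)) ∧ (∀ j, IsAffineFunction D (yCoord π F j)) ∧
        ∀ D' : Connection (Fin n → ℂ) M, (∀ i, IsAffineFunction D' (xCoord π i)) →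
          (∀ j, IsAffineFunction D' (yCoord π F j)) →
          ∀ (p : M) (Y : VField (Fin n → ℂ) M), Y.SmoothAt p → D' Y p = D Y p) ∧
      -- `M(F)` is a special Kähler manifold with Kähler form `g(·, J·) = 2 ∑ dx̃ⁱ ∧ dỹᵢ`
      IsSpecialKaehler complexStructure (specialMetric π F) D ∧
      (∀ (p : M) (v w : TangentSpace 𝓘(ℝ, Fin n → ℂ) p),
        specialMetric π F p v (complexStructure p w) =
          2 * ∑ i, (dirDeriv (xCoord π i) p v * dirDeriv (yCoord π F i) p w
            - dirDeriv (xCoord π i) p w * dirDeriv (yCoord π F i) p v)) ∧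
      -- `φ_F` is a special parabolic hypersphere with affine normal `∂_{2n+1}`
      ∃ o : ManifoldOrientation (Fin n → ℂ) M (n + n),
        IsSpecialParabolicHypersphere (standardVol n) o (phiF π F)
          (fun _ ↦ Pi.single (Fin.last (n + n)) 1) (specialMetric π F) D complexStructure ∧
        -- uniqueness up to unimodular affine transformations
        ∀ (o' : ManifoldOrientation (Fin n → ℂ) M (n + n)) (ψ ξ : M → Fin (n + n + 1) → ℝ),
          IsSpecialParabolicHypersphere (standardVol n) o' ψ ξ (specialMetric π F) D
            complexStructure →
          ∃ A : (Fin (n + n + 1) → ℝ) ≃ᵃ[ℝ] (Fin (n + n + 1) → ℝ),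
            |LinearMap.det (A.linear : (Fin (n + n + 1) → ℝ) →ₗ[ℝ] (Fin (n + n + 1) → ℝ))| = 1 ∧
            (o' = o →
              LinearMap.det (A.linear : (Fin (n + n + 1) → ℝ) →ₗ[ℝ] (Fin (n + n + 1) → ℝ)) = 1) ∧
            ∀ p, ψ p = A (phiF π F p) := by
  have hφ := isSpecialParabolicHypersphere_phiF hπ.unramified hF hnd hn
  exact ⟨_, ⟨isAffineFunction_xCoord hπ.unramified hF hnd,
      isAffineFunction_yCoord hπ.unramified hF hnd,
      fun D' hx hy p Y hY ↦ eq_connection_of_isAffineFunction hπ.unramified hF hnd hx hy hY⟩,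
    isSpecialKaehler_specialMetric hπ.unramified hF hnd,
    kaehlerForm_specialMetric hπ.unramified hF hnd, _, hφ,
    fun o' ψ ξ hψ ↦ IsDevelopingMap.exists_affineEquiv_of_isSpecialParabolicHypersphere _ hφ hψ⟩
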